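/- For a finite connected simple graph $H$ with at least two vertices, let $P=\Delta^{-1}A$ be the transition matrix of the random walk on $H$, where $A$ is the adjacency matrix and $\Delta$ the diagonal matrix of vertex degrees. Let $w$ be its stationary distribution vector and $m_{j,k}$ the mean first passage time from $j$ to $k$. Kemeny's constant of $H$ is $\mathcal K(H)=\sum_{k\ne j} m_{j,k}w_k$, which does not depend on the vertex $j$. **Theorem 3.1.** Let $T$ be a tree on $n\ge 4$ vertices, let $u,v$ be distinct non-adjacent vertices of $T$, and let $G$ be the graph obtained from $T$ by adding the edge $uv$. Let $c$ be the length of the unique cycle of $G$. Then $$ \begin{aligned} \mathcal K(G)-\mathcal K(T)\le \frac{1}{4cn(n-1)}\Big\{ & 4c\cdot\tfrac23 (n-c+1)(n-c)(n-c-1)\\ & -8(n-c)\Big(-nc\left\lfloor\tfrac{c+1}{2}\right\rfloor\left\lceil\tfrac{c+1}{2}\right\rceil+\tfrac{c(c+1)}{6}\big((2n+1)c+n-1\big)\Big)\\ & -\tfrac{4(n+1)c^2(c^2-1)}{6}+4n(n-1)c(c-1)+2(n-1)c^2\Big\}. \end{aligned} $$ Moreover, equality holds if and only if $T$ is the tree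 obtained by identifying an end vertex of the path $P_{n-c+1}$ with the middle vertex (or one of the two middle vertices if $c$ is even) of a path $P_c$ whose two ends are $u$ and $v$. Here $P_k$ denotes the path on $k$ vertices. -/

import Mathlib

open scoped NNReal ENNReal

section MarkovChain

variable {V : Type*} [Fintype V] [DecidableEq V]

/-- `avoidProb P k t j` is the probability that the Markov chain with transition matrix `P`, started
at `j`, is not at `k` at any of the times `1, …, t` (the starting state itself may be `k`). In other
words it is the probability that the first passage time `min {s ≥ 1 : X s = k}` exceeds `t`. -/
noncomputable def avoidProb (P : Matrix V V ℝ≥0) (k : V) : ℕ → V → ℝ≥0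
  | 0, _ => 1
  | t + 1, j => ∑ l ∈ Finset.univ.erase k, P j l * avoidProb P k t l

/-- The mean first passage time from `j` to `k`: the expectation, possibly infinite, of the first
passage time `τ`, as the sum over `t ≥ 0` of the probabilities of `τ > t`. -/
noncomputable def meanFirstPassage (P : Matrix V V ℝ≥0) (j k : V) : ℝ≥0∞ :=
  ∑' t : ℕ, (avoidProb P k t j : ℝ≥0∞)

/-- `w` is a stationary distribution vector of the chain with transition matrix `P`. -/
def IsStationaryDistribution (P : Matrix V V ℝ≥0) (w : V → ℝ≥0) : Prop :=
  ∑ j, w j = 1 ∧ Matrix.vecMul w P = w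

/-- `κ` is Kemeny's constant of the chain with transition matrix `P`: there is a stationary
distribution, and for each such `w` and each initial state `j`, the sum over `k ≠ j` of the mean
first passage time from `j` to `k`, weighted by `w k`, is equal to `κ`. At most one `κ` satisfies
this. -/
def IsKemenyConstant (P : Matrix V V ℝ≥0) (κ : ℝ≥0) : Prop :=
  (∃ w, IsStationaryDistribution P w) ∧
    ∀ w, IsStationaryDistribution P w → ∀ j,
      ∑ k ∈ Finset.univ.erase j, meanFirstPassage P j k * (w k : ℝ≥0∞) = (κ : ℝ≥0∞)

end MarkovChain

namespace SimpleGraph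

variable {V : Type*} [Fintype V] [DecidableEq V]

open Classical in
/-- The transition matrix of the random walk on `G`: the inverse of the diagonal matrix of vertex
degrees times the adjacency matrix. -/
noncomputable def randomWalkMatrix (G : SimpleGraph V) : Matrix V V ℝ≥0 :=
  Matrix.diagonal (fun v => (G.degree v : ℝ≥0)⁻¹) * G.adjMatrix ℝ≥0

/-- `T` is the graph obtained from a path on `c` vertices (embedded in `V` by `f`) with ends `u` and
`v`, and a path on `n - c + 1` vertices (embedded by `g`), `n` being the number of vertices of `T`,
by identifying an end vertex of the latter with a middle vertex of the former. With the
vertices of the first path numbered `0, …, c - 1`, its middle vertices are those whose number plus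
one is the floor or the ceiling of `(c + 1) / 2`. -/
def IsTShaped (T : SimpleGraph V) (u v : V) (c : ℕ) : Prop :=
  ∃ (f : Fin c ↪ V) (g : Fin (Fintype.card V - c + 1) ↪ V) (i : Fin c),
    (∀ a : Fin c, (a : ℕ) = 0 → f a = u) ∧
    (∀ a : Fin c, (a : ℕ) + 1 = c → f a = v) ∧
    ((i : ℕ) + 1 = (c + 1) / 2 ∨ (i : ℕ) + 1 = (c + 2) / 2) ∧
    g 0 = f i ∧
    Set.range f ∩ Set.range g = {f i} ∧
    Set.range f ∪ Set.range g = Set.univ ∧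
    T = (pathGraph c).map f ⊔ (pathGraph (Fintype.card V - c + 1)).map g

end SimpleGraph

/-- The upper bound for the increase of Kemeny's constant when an edge that creates a cycle of
length `c` is added to a tree on `n` vertices. -/
noncomputable def kemenyIncreaseBound (n c : ℕ) : ℝ :=
  1 / (4 * (c : ℝ) * n * (n - 1)) *
    (4 * c * (2 / 3) * (n - c + 1) * (n - c) * (n - c - 1)
      - 8 * (n - c) *
        (-(n * c * ⌊((c : ℝ) + 1) / 2⌋ * ⌈((c : ℝ) + 1) / 2⌉)
          + (c * (c + 1) / 6) * ((2 * n + 1) * c + n - 1))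
      - 4 * (n + 1) * c ^ 2 * (c ^ 2 - 1) / 6
      + 4 * n * (n - 1) * c * (c - 1) + 2 * (n - 1) * c ^ 2)

section MarkovChain

variable {V : Type*} [Fintype V] [DecidableEq V]

theorem sum_avoidProb_succ (P : Matrix V V ℝ≥0) (k : V) (t : ℕ) (j : V) :
    ∑ s ∈ Finset.range (t + 1), avoidProb P k s j =
      1 + ∑ l ∈ Finset.univ.erase k, P j l * ∑ s ∈ Finset.range t, avoidProb P k s l := by
  rw [Finset.sum_range_succ', add_comm]
  simp only [avoidProb, Finset.mul_sum]
  rw [Finset.sum_comm]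

/-- A finite solution of the first step equations gives the mean first passage times. -/
theorem meanFirstPassage_eq_of_firstStep {P : Matrix V V ℝ≥0} {k : V} {h : V → ℝ≥0}
    (hh : ∀ j, j ≠ k → h j = 1 + ∑ l ∈ Finset.univ.erase k, P j l * h l) {j : V} (hj : j ≠ k) :
    meanFirstPassage P j k = h j := by
  have hle : ∀ t, ∀ j, j ≠ k → ∑ s ∈ Finset.range t, avoidProb P k s j ≤ h j := by
    intro t
    induction t with
    | zero => intro j _; simp
    | succ t ih =>
      intro j hj
      rw [sum_avoidProb_succ, hh j hj]
      gcongr with l hl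
      exact ih l (Finset.ne_of_mem_erase hl)
  have hge : ∀ t, ∀ j, j ≠ k → h j ≤ ∑ s ∈ Finset.range t, avoidProb P k s j +
      (∑ l, h l) * avoidProb P k t j := by
    intro t
    induction t with
    | zero =>
      intro j _
      simpa [avoidProb] using Finset.single_le_sum (f := h) (fun i _ => zero_le)
        (Finset.mem_univ j)
    | succ t ih =>
      intro j hj
      rw [sum_avoidProb_succ, hh j hj, avoidProb, add_assoc, Finset.mul_sum,
        ← Finset.sum_add_distrib]
      gcongr with l hl
      refine (mul_le_mul_right (ih l (Finset.ne_of_mem_erase hl)) _).trans (le_of_eq ?_)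
      ring
  have hsum : Summable fun t => avoidProb P k t j :=
    NNReal.summable_of_sum_range_le fun t => hle t j hj
  have hlim := hsum.hasSum.tendsto_sum_nat
  have heq : ∑' t, avoidProb P k t j = h j := by
    apply le_antisymm
    · exact le_of_tendsto' hlim fun t => hle t j hj
    · have h2 := hlim.add ((NNReal.tendsto_atTop_zero_of_summable hsum).const_mul (∑ l, h l))
      rw [mul_zero, add_zero] at h2
      exact ge_of_tendsto' h2 fun t => hge t j hj
  rw [meanFirstPassage, ← ENNReal.coe_tsum hsum, heq]

end MarkovChain

namespace SimpleGraph

variable {V : Type*} [Fintype V] [DecidableEq V]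

open Classical in
theorem randomWalkMatrix_apply (G : SimpleGraph V) (i j : V) :
    (G.randomWalkMatrix i j : ℝ) = (G.degree i : ℝ)⁻¹ * G.adjMatrix ℝ i j := by
  rw [randomWalkMatrix, Matrix.diagonal_mul, adjMatrix_apply, adjMatrix_apply]
  split_ifs <;> simp

omit [DecidableEq V] in
open Classical in
theorem sum_adjMatrix (G : SimpleGraph V) (i : V) : ∑ j, G.adjMatrix ℝ i j = G.degree i := by
  simp [adjMatrix_apply, degree_eq_sum_if_adj]

open Classical in
theorem isStationaryDistribution_iff {G : SimpleGraph V} (hG : G.Connected) [Nontrivial V]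
    (w : V → ℝ≥0) : IsStationaryDistribution G.randomWalkMatrix w ↔
      ∀ j, (w j : ℝ) = G.degree j / ∑ i, (G.degree i : ℝ) := by
  have hd : ∀ j, (0 : ℝ) < G.degree j := fun j => by
    exact_mod_cast hG.preconnected.degree_pos_of_nontrivial j
  have hD : (0 : ℝ) < ∑ i, (G.degree i : ℝ) :=
    Finset.sum_pos (fun i _ => hd i) Finset.univ_nonempty
  have hst : IsStationaryDistribution G.randomWalkMatrix w ↔ ∑ j, (w j : ℝ) = 1 ∧
      ∀ j, ∑ i, (w i : ℝ) / G.degree i * G.adjMatrix ℝ i j = w j := by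
    rw [IsStationaryDistribution, funext_iff, ← NNReal.coe_inj]
    simp only [← NNReal.coe_inj (r₁ := Matrix.vecMul _ _ _)]
    simp [Matrix.vecMul, dotProduct, randomWalkMatrix_apply, div_eq_mul_inv]
  rw [hst]
  constructor
  · rintro ⟨h1, h2⟩
    have hL : (G.lapMatrix ℝ).mulVec (fun j => (w j : ℝ) / G.degree j) = 0 := by
      ext j
      rw [lapMatrix_mulVec_apply, mul_div_cancel₀ _ (hd j).ne', ← adjMatrix_mulVec_apply, ← h2 j,
        Matrix.mulVec, dotProduct, Pi.zero_apply, sub_eq_zero]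
      refine Finset.sum_congr rfl fun i _ => ?_
      rw [mul_comm, (G.isSymm_adjMatrix (α := ℝ)).apply]
    rw [lapMatrix_mulVec_eq_zero_iff_forall_reachable] at hL
    intro j
    have h3 : ∀ i, (w i : ℝ) = G.degree i * (w j / G.degree j) := fun i => by
      rw [← hL i j (hG.preconnected i j), mul_div_cancel₀ _ (hd i).ne']
    rw [Finset.sum_congr rfl fun i _ => h3 i, ← Finset.sum_mul] at h1
    have := (hd j).ne'
    field_simp at h1 ⊢
    linarith
  · intro h
    refine ⟨?_, fun j => ?_⟩
    · simp only [h]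
      rw [← Finset.sum_div, div_self hD.ne']
    · have : ∀ i, (w i : ℝ) / G.degree i * G.adjMatrix ℝ i j =
          G.adjMatrix ℝ j i * (∑ i, (G.degree i : ℝ))⁻¹ := fun i => by
        rw [h i, (G.isSymm_adjMatrix (α := ℝ)).apply]
        have := (hd i).ne'
        field_simp
      simp only [this]
      rw [← Finset.sum_mul, sum_adjMatrix, h j, div_eq_mul_inv]

open Classical in
/-- Kemeny's constant from the effective resistances `R`, characterized by
the equation `L R = a 1ᵀ - 2 I`. -/
theorem exists_isKemenyConstant {G : SimpleGraph V} (hG : G.Connected) [Nontrivial V]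
    (R : V → V → ℝ) (a : V → ℝ) (hdiag : ∀ z, R z z = 0)
    (hR : ∀ j z, ∑ l, G.adjMatrix ℝ j l * (R j z - R l z) = a j - if j = z then 2 else 0) :
    ∃ κ : ℝ≥0, IsKemenyConstant G.randomWalkMatrix κ ∧
      (κ : ℝ) = (∑ i, ∑ j, (G.degree i : ℝ) * G.degree j * R i j) /
        (2 * ∑ i, (G.degree i : ℝ)) := by
  have hd : ∀ j, (0 : ℝ) < G.degree j := fun j => by
    exact_mod_cast hG.preconnected.degree_pos_of_nontrivial j
  set D := ∑ i, (G.degree i : ℝ) with hDdef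
  have hD : 0 < D := Finset.sum_pos (fun i _ => hd i) Finset.univ_nonempty
  set h : V → V → ℝ := fun k j => (∑ z, G.degree z * (R j k + R k z - R j z)) / 2 with hh
  have hkk : ∀ k, h k k = 0 := fun k => by simp [hh, hdiag]
  have hLap : ∀ k j, j ≠ k → ∑ l, G.adjMatrix ℝ j l * (h k j - h k l) = G.degree j := by
    intro k j hjk
    have h1 : ∀ l, G.adjMatrix ℝ j l * (h k j - h k l) = ∑ z, (G.degree z : ℝ) / 2 *
        (G.adjMatrix ℝ j l * (R j k - R l k) - G.adjMatrix ℝ j l * (R j z - R l z)) := by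
      intro l
      simp only [hh]
      rw [← sub_div, ← Finset.sum_sub_distrib, Finset.sum_div, Finset.mul_sum]
      refine Finset.sum_congr rfl fun z _ => ?_
      ring
    simp only [h1]
    rw [Finset.sum_comm]
    simp only [← Finset.mul_sum, Finset.sum_sub_distrib, hR, hjk, if_false]
    simp
  have hstep : ∀ k j, j ≠ k → h k j = 1 + ∑ l, G.randomWalkMatrix j l * h k l := by
    intro k j hjk
    have h1 := hLap k j hjk
    simp only [mul_sub, Finset.sum_sub_distrib, ← Finset.sum_mul, sum_adjMatrix] at h1
    simp only [randomWalkMatrix_apply, mul_assoc, ← Finset.mul_sum]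
    have := (hd j).ne'
    field_simp
    linarith
  have hnn : ∀ k j, 0 ≤ h k j := by
    intro k
    obtain ⟨m, hm⟩ := Finite.exists_min (h k)
    intro j
    rcases eq_or_ne m k with rfl | hmk
    · exact (hkk m).symm.le.trans (hm j)
    · exfalso
      have h1 := hLap k m hmk
      have h2 : ∑ l, G.adjMatrix ℝ m l * (h k m - h k l) ≤ 0 := by
        refine Finset.sum_nonpos fun l _ => mul_nonpos_of_nonneg_of_nonpos ?_ ?_
        · rw [adjMatrix_apply]; positivity
        · linarith [hm l]
      linarith [hd m]
  have hmfp : ∀ j k, j ≠ k → meanFirstPassage G.randomWalkMatrix j k = (h k j).toNNReal := by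
    intro j k hjk
    refine meanFirstPassage_eq_of_firstStep (h := fun j => (h k j).toNNReal) (fun j hj => ?_) hjk
    rw [← NNReal.coe_inj]
    push_cast
    simp only [Real.coe_toNNReal _ (hnn _ _)]
    rw [hstep k j hj, ← Finset.add_sum_erase _ _ (Finset.mem_univ k), hkk]
    simp
  have hsum : ∀ j, ∑ k, h k j * (G.degree k / D) =
      (∑ i, ∑ j, (G.degree i : ℝ) * G.degree j * R i j) / (2 * D) := by
    intro j
    have h1 : ∀ k, h k j * (G.degree k / D) =
        (D * (G.degree k * R j k) + ∑ z, (G.degree k : ℝ) * G.degree z * R k z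
          - G.degree k * ∑ z, G.degree z * R j z) / (2 * D) := by
      intro k
      have : h k j = (D * R j k + ∑ z, G.degree z * R k z - ∑ z, G.degree z * R j z) / 2 := by
        simp only [hh, mul_sub, mul_add, Finset.sum_add_distrib, Finset.sum_sub_distrib,
          ← Finset.sum_mul, hDdef]
      rw [this]
      simp only [mul_assoc, ← Finset.mul_sum]
      field_simp
    simp only [h1]
    rw [← Finset.sum_div, Finset.sum_sub_distrib, Finset.sum_add_distrib, ← Finset.mul_sum,
      ← Finset.sum_mul, ← hDdef]
    congr 1
    ring
  have hnn' : 0 ≤ (∑ i, ∑ j, (G.degree i : ℝ) * G.degree j * R i j) / (2 * D) := by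
    obtain ⟨j⟩ : Nonempty V := inferInstance
    rw [← hsum j]
    exact Finset.sum_nonneg fun k _ => mul_nonneg (hnn k j) (by positivity)
  refine ⟨Real.toNNReal _, ⟨⟨fun j => (G.degree j / D).toNNReal, ?_⟩, ?_⟩, Real.coe_toNNReal _ hnn'⟩
  · rw [isStationaryDistribution_iff hG]
    intro j
    exact Real.coe_toNNReal _ (by positivity)
  · intro w hw j
    rw [isStationaryDistribution_iff hG] at hw
    have h1 : ∀ k ∈ Finset.univ.erase j, meanFirstPassage G.randomWalkMatrix j k * (w k : ℝ≥0∞) =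
        (((h k j).toNNReal * w k : ℝ≥0) : ℝ≥0∞) := by
      intro k hk
      rw [hmfp j k (Finset.ne_of_mem_erase hk).symm, ENNReal.coe_mul]
    rw [Finset.sum_congr rfl h1, ← ENNReal.ofNNReal_finsetSum, ENNReal.coe_inj, ← NNReal.coe_inj]
    push_cast
    simp only [Real.coe_toNNReal _ (hnn _ _), hw, Real.coe_toNNReal _ hnn']
    rw [← hDdef, ← hsum j, ← Finset.add_sum_erase Finset.univ (fun k => h k j * (G.degree k / D))
      (Finset.mem_univ j), hkk, zero_mul, zero_add]

end SimpleGraph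

namespace SimpleGraph

variable {V : Type*} {T : SimpleGraph V}

theorem IsTree.existsUnique_adj_dist (hT : T.IsTree) {j z : V} (hjz : j ≠ z) :
    ∃! l, T.Adj j l ∧ T.dist j z = T.dist l z + 1 := by
  obtain ⟨p, hp⟩ := hT.connected.exists_walk_length_eq_dist j z
  cases p with
  | nil => exact absurd rfl hjz
  | @cons _ l _ hl q =>
    rw [Walk.length_cons] at hp
    refine ⟨l, ⟨hl, ?_⟩, ?_⟩
    · have h1 := dist_le q
      have h2 := hT.connected.dist_triangle (u := j) (v := l) (w := z)
      rw [dist_eq_one_iff_adj.mpr hl] at h2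
      omega
    · rintro l' ⟨hl', hd⟩
      obtain ⟨q', hq'⟩ := hT.connected.exists_walk_length_eq_dist l' z
      have h1 := (Walk.cons hl q).isPath_of_length_eq_dist (by rw [Walk.length_cons, hp])
      have h2 := (Walk.cons hl' q').isPath_of_length_eq_dist (by rw [Walk.length_cons, hq', hd])
      have h3 := (hT.isAcyclic.subsingleton_path _ _).elim ⟨_, h1⟩ ⟨_, h2⟩
      simp only [Subtype.mk.injEq, Walk.cons.injEq] at h3
      exact h3.1.symm

variable [Fintype V]

open Classical in
theorem IsTree.sum_adjMatrix_mul_dist_sub [DecidableEq V] (hT : T.IsTree) (j z : V) :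
    ∑ l, T.adjMatrix ℝ j l * ((T.dist j z : ℝ) - T.dist l z) =
      2 - T.degree j - if j = z then 2 else 0 := by
  rcases eq_or_ne j z with rfl | hjz
  · rw [if_pos rfl, ← sum_adjMatrix, sub_right_comm, sub_self, zero_sub, ← Finset.sum_neg_distrib]
    refine Finset.sum_congr rfl fun l _ => ?_
    by_cases h : T.Adj j l
    · simp [adjMatrix_apply, h, dist_eq_one_iff_adj.mpr h.symm]
    · simp [adjMatrix_apply, h]
  · obtain ⟨p, ⟨hp, hd⟩, hu⟩ := hT.existsUnique_adj_dist hjz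
    have h1 : ∀ l, T.adjMatrix ℝ j l * ((T.dist j z : ℝ) - T.dist l z) =
        (if l = p then 2 else 0) - T.adjMatrix ℝ j l := by
      intro l
      rcases eq_or_ne l p with rfl | hlp
      · simp [adjMatrix_apply, hp, hd]; norm_num
      · by_cases h : T.Adj j l
        · have h2 := hT.dist_eq_dist_add_one_of_adj z h
          rw [dist_comm, dist_comm (u := z)] at h2
          rcases h2 with h2 | h2
          · exact absurd (hu l ⟨h, h2⟩) hlp
          · simp [adjMatrix_apply, h, hlp, h2]
        · simp [adjMatrix_apply, h, hlp]
    simp only [h1, Finset.sum_sub_distrib, sum_adjMatrix, if_neg hjz]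
    simp

open Classical in
theorem sum_sum_adjMatrix_mul_sub (G : SimpleGraph V) (φ : V → ℝ) :
    ∑ j, ∑ l, G.adjMatrix ℝ j l * (φ j - φ l) = 0 := by
  simp only [mul_sub, Finset.sum_sub_distrib]
  rw [Finset.sum_comm (f := fun j l => G.adjMatrix ℝ j l * φ l), sub_eq_zero]
  refine Finset.sum_congr rfl fun j _ => Finset.sum_congr rfl fun l _ => ?_
  rw [(G.isSymm_adjMatrix (α := ℝ)).apply]

omit [Fintype V] in
theorem IsTree.sq_dist_sub_dist (hT : T.IsTree) (z : V) {j l : V} (h : T.Adj j l) :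
    ((T.dist j z : ℝ) - T.dist l z) ^ 2 = 1 := by
  have h2 := hT.dist_eq_dist_add_one_of_adj z h
  rw [dist_comm, dist_comm (u := z)] at h2
  rcases h2 with h2 | h2 <;> rw [h2] <;> push_cast <;> ring

open Classical in
theorem IsTree.sum_degree (hT : T.IsTree) :
    ∑ j, (T.degree j : ℝ) = 2 * (Fintype.card V - 1) := by
  obtain ⟨z⟩ := hT.connected.nonempty
  have h := T.sum_sum_adjMatrix_mul_sub fun j => (T.dist j z : ℝ)
  simp only [hT.sum_adjMatrix_mul_dist_sub, Finset.sum_sub_distrib] at h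
  simp at h
  linarith

open Classical in
theorem IsTree.sum_degree_mul_dist (hT : T.IsTree) (z : V) :
    ∑ j, (T.degree j : ℝ) * T.dist j z = 2 * ∑ j, (T.dist j z : ℝ) - (Fintype.card V - 1) := by
  have h := T.sum_sum_adjMatrix_mul_sub fun j => (T.dist j z : ℝ) ^ 2
  have h1 : ∀ j, ∑ l, T.adjMatrix ℝ j l * ((T.dist j z : ℝ) ^ 2 - T.dist l z ^ 2) =
      4 * T.dist j z - 2 * (T.degree j * T.dist j z) - T.degree j := by
    intro j
    have h2 : ∀ l, T.adjMatrix ℝ j l * ((T.dist j z : ℝ) ^ 2 - T.dist l z ^ 2) =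
        2 * T.dist j z * (T.adjMatrix ℝ j l * ((T.dist j z : ℝ) - T.dist l z)) -
          T.adjMatrix ℝ j l := by
      intro l
      by_cases h : T.Adj j l
      · have := hT.sq_dist_sub_dist z h
        simp only [adjMatrix_apply, h, if_true]
        linear_combination -this
      · simp [adjMatrix_apply, h]
    simp only [h2, Finset.sum_sub_distrib, ← Finset.mul_sum, hT.sum_adjMatrix_mul_dist_sub,
      sum_adjMatrix]
    rcases eq_or_ne j z with rfl | hjz
    · simp
    · rw [if_neg hjz]; ring
  simp only [h1, Finset.sum_sub_distrib, ← Finset.mul_sum, hT.sum_degree] at h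
  linarith

open Classical in
/-- Summing the degrees over the fibres of the projection to the path from `u` to `v`. -/
theorem IsTree.sum_degree_mul (hT : T.IsTree) (u v : V) (φ : ℝ → ℝ) (ψ : V → ℝ)
    (hψ : ∀ j, ψ j = φ ((T.dist j u : ℝ) - T.dist j v)) :
    ∑ j, (T.degree j : ℝ) * ψ j + ψ u + ψ v = 2 * ∑ j, ψ j := by
  have key : ∀ z, ∑ j, ∑ l, T.adjMatrix ℝ j l *
      (((T.dist j z : ℝ) - T.dist l z) * (ψ j - ψ l)) =
      2 * ∑ j, (2 - T.degree j - if j = z then 2 else 0) * ψ j := by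
    intro z
    simp only [← hT.sum_adjMatrix_mul_dist_sub, Finset.sum_mul]
    rw [two_mul]
    nth_rewrite 2 [Finset.sum_comm]
    simp only [← Finset.sum_add_distrib]
    refine Finset.sum_congr rfl fun j _ => Finset.sum_congr rfl fun l _ => ?_
    rw [(T.isSymm_adjMatrix (α := ℝ)).apply j l]
    ring
  have hzero : ∀ j l, T.adjMatrix ℝ j l * (((T.dist j u : ℝ) - T.dist l u) * (ψ j - ψ l)) +
      T.adjMatrix ℝ j l * (((T.dist j v : ℝ) - T.dist l v) * (ψ j - ψ l)) = 0 := by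
    intro j l
    by_cases h : T.Adj j l
    · have hu := hT.sq_dist_sub_dist u h
      have hv := hT.sq_dist_sub_dist v h
      rcases sq_eq_sq_iff_eq_or_eq_neg.mp (hu.trans hv.symm) with h1 | h1
      · have : ψ j = ψ l := by
          rw [hψ, hψ]; congr 1; linarith
        rw [this]; ring
      · rw [h1]; ring
    · simp [adjMatrix_apply, h]
  have h0 := key u
  have h1 := key v
  have h2 : ∑ j, ∑ l, T.adjMatrix ℝ j l * (((T.dist j u : ℝ) - T.dist l u) * (ψ j - ψ l)) +
      ∑ j, ∑ l, T.adjMatrix ℝ j l * (((T.dist j v : ℝ) - T.dist l v) * (ψ j - ψ l)) = 0 := by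
    simp only [← Finset.sum_add_distrib, hzero, Finset.sum_const_zero]
  rw [h0, h1] at h2
  simp only [sub_mul, Finset.sum_sub_distrib, ite_mul, zero_mul, Finset.sum_ite_eq',
    Finset.mem_univ, if_true, ← Finset.mul_sum] at h2
  linarith

end SimpleGraph

namespace SimpleGraph

variable {V : Type*} [DecidableEq V] {T G : SimpleGraph V} {u v : V}

open Classical in
theorem adjMatrix_sup_edge (hG : G = T ⊔ edge u v) (huv : u ≠ v) (hnadj : ¬ T.Adj u v) (j l : V) :
    G.adjMatrix ℝ j l = T.adjMatrix ℝ j l +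
      ((if j = u then (if l = v then 1 else 0) else 0) +
        if j = v then (if l = u then 1 else 0) else 0) := by
  have hnadj' : ¬ T.Adj v u := fun h => hnadj h.symm
  simp only [adjMatrix_apply, hG, sup_adj, edge_adj]
  rcases eq_or_ne j u with rfl | hju
  · rcases eq_or_ne l v with rfl | hlv
    · simp [hnadj, huv]
    · simp [hlv, huv]
  · rcases eq_or_ne j v with rfl | hjv
    · rcases eq_or_ne l u with rfl | hlu
      · simp [hnadj', huv.symm]
      · simp [hlu, hju]
    · simp [hju, hjv]

variable [Fintype V]

open Classical in
theorem degree_sup_edge (hG : G = T ⊔ edge u v) (huv : u ≠ v) (hnadj : ¬ T.Adj u v) (j : V) :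
    (G.degree j : ℝ) =
      T.degree j + ((if j = u then 1 else 0) + if j = v then 1 else 0) := by
  rw [← sum_adjMatrix, ← sum_adjMatrix]
  simp only [adjMatrix_sup_edge hG huv hnadj, Finset.sum_add_distrib]
  congr 2 <;> split_ifs <;> simp

open Classical in
/-- The effective resistances of a tree with one more edge. -/
theorem IsTree.sum_adjMatrix_sup_edge_mul (hT : T.IsTree) (hG : G = T ⊔ edge u v) (huv : u ≠ v) (hnadj : ¬ T.Adj u v) :
    ∃ a : V → ℝ, ∀ j z, ∑ l, G.adjMatrix ℝ j l *
      ((T.dist j z - (((T.dist j u : ℝ) - T.dist j v) / 2 - ((T.dist z u : ℝ) - T.dist z v) / 2) ^ 2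
          / (T.dist u v + 1)) -
        (T.dist l z - (((T.dist l u : ℝ) - T.dist l v) / 2 - ((T.dist z u : ℝ) - T.dist z v) / 2) ^ 2
          / (T.dist u v + 1))) = a j - if j = z then 2 else 0 := by
  set c : ℝ := T.dist u v + 1 with hc
  have hc0 : c ≠ 0 := by positivity
  set q : V → ℝ := fun j => ((T.dist j u : ℝ) - T.dist j v) / 2 with hq
  have hqu : q u = -(c - 1) / 2 := by simp [hq, hc]
  have hqv : q v = (c - 1) / 2 := by simp [hq, hc, dist_comm]
  have hTq : ∀ j, ∑ l, T.adjMatrix ℝ j l * (q j - q l) =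
      (if j = v then 1 else 0) - if j = u then 1 else 0 := by
    intro j
    have : ∀ l, T.adjMatrix ℝ j l * (q j - q l) =
        (T.adjMatrix ℝ j l * ((T.dist j u : ℝ) - T.dist l u) -
          T.adjMatrix ℝ j l * ((T.dist j v : ℝ) - T.dist l v)) / 2 := by
      intro l; simp only [hq]; ring
    simp only [this]
    rw [← Finset.sum_div, Finset.sum_sub_distrib, hT.sum_adjMatrix_mul_dist_sub,
      hT.sum_adjMatrix_mul_dist_sub]
    split_ifs <;> ring
  have hsum : ∀ (f : V → ℝ) (j : V), ∑ l, G.adjMatrix ℝ j l * f l =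
      ∑ l, T.adjMatrix ℝ j l * f l + ((if j = u then f v else 0) + if j = v then f u else 0) := by
    intro f j
    simp only [adjMatrix_sup_edge hG huv hnadj, add_mul, Finset.sum_add_distrib]
    congr 2 <;> split_ifs <;> simp
  refine ⟨fun j => 2 - T.degree j -
    (∑ l, G.adjMatrix ℝ j l * (q j ^ 2 - q l ^ 2)) / c, fun j z => ?_⟩
  have h1 : ∀ l, G.adjMatrix ℝ j l *
      ((T.dist j z - (q j - q z) ^ 2 / c) - (T.dist l z - (q l - q z) ^ 2 / c)) =
      G.adjMatrix ℝ j l * ((T.dist j z : ℝ) - T.dist l z) -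
      G.adjMatrix ℝ j l * (q j ^ 2 - q l ^ 2) / c +
      2 * q z / c * (G.adjMatrix ℝ j l * (q j - q l)) := by
    intro l; ring
  change ∑ l, G.adjMatrix ℝ j l *
      ((T.dist j z - (q j - q z) ^ 2 / c) - (T.dist l z - (q l - q z) ^ 2 / c)) = _
  simp only [h1]
  rw [Finset.sum_add_distrib, Finset.sum_sub_distrib, ← Finset.sum_div, ← Finset.mul_sum,
    hsum (fun l => q j - q l), hTq, hsum (fun l => (T.dist j z : ℝ) - T.dist l z),
    hT.sum_adjMatrix_mul_dist_sub]
  have hz : q z = ((T.dist u z : ℝ) - T.dist v z) / 2 := by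
    simp only [hq]; rw [dist_comm, dist_comm (u := z)]
  rcases eq_or_ne j u with rfl | hju
  · simp only [if_true, if_neg huv, hqu, hqv]
    field_simp
    rw [hz]; ring
  · rcases eq_or_ne j v with rfl | hjv
    · simp only [if_true, if_neg huv.symm, hqu, hqv]
      field_simp
      rw [hz]; ring
    · simp only [if_neg hju, if_neg hjv, mul_div_assoc]
      ring

omit [DecidableEq V] in
open Classical in
theorem IsTree.sum_sum_degree_mul_dist (hT : T.IsTree) :
    ∑ i, ∑ j, (T.degree i : ℝ) * T.degree j * T.dist i j =
      4 * ∑ i, ∑ j, (T.dist i j : ℝ) - 2 * (Fintype.card V - 1) * (2 * Fintype.card V - 1) := by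
  have h1 : ∀ i, ∑ j, (T.degree i : ℝ) * T.degree j * T.dist i j =
      T.degree i * (2 * ∑ j, (T.dist i j : ℝ) - (Fintype.card V - 1)) := by
    intro i
    have h := hT.sum_degree_mul_dist i
    simp only [T.dist_comm (v := i)] at h
    simp only [mul_assoc, ← Finset.mul_sum, h]
  have h2 : ∑ i, (T.degree i : ℝ) * ∑ j, (T.dist i j : ℝ) =
      2 * ∑ i, ∑ j, (T.dist i j : ℝ) - Fintype.card V * (Fintype.card V - 1) := by
    simp only [Finset.mul_sum]
    rw [Finset.sum_comm]
    simp only [hT.sum_degree_mul_dist, Finset.sum_sub_distrib, ← Finset.mul_sum]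
    rw [Finset.sum_comm]
    simp
    ring
  simp only [h1, mul_sub, Finset.sum_sub_distrib, mul_left_comm _ (2 : ℝ), ← Finset.mul_sum, h2,
    ← Finset.sum_mul, hT.sum_degree]
  ring

open Classical in
theorem IsTree.sum_sum_degree_sup_edge_mul_dist (hT : T.IsTree) (hG : G = T ⊔ edge u v) (huv : u ≠ v)
    (hnadj : ¬ T.Adj u v) :
    ∑ i, ∑ j, (G.degree i : ℝ) * G.degree j * T.dist i j =
      4 * ∑ i, ∑ j, (T.dist i j : ℝ) - 2 * (Fintype.card V - 1) * (2 * Fintype.card V - 1) +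
        4 * ∑ i, ((T.dist i u : ℝ) + T.dist i v) - 4 * (Fintype.card V - 1) + 2 * T.dist u v := by
  have h1 : ∀ i, ∑ j, (G.degree i : ℝ) * G.degree j * T.dist i j =
      (G.degree i : ℝ) *
        (∑ j, (T.degree j : ℝ) * T.dist i j + (T.dist i u + T.dist i v)) := by
    intro i
    simp only [mul_assoc, ← Finset.mul_sum]
    simp only [degree_sup_edge hG huv hnadj, add_mul, Finset.sum_add_distrib]
    simp
  have hu : ∀ z, ∑ j, (T.degree j : ℝ) * T.dist z j =
      2 * ∑ j, (T.dist j z : ℝ) - (Fintype.card V - 1) := by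
    intro z
    rw [← hT.sum_degree_mul_dist z]
    exact Finset.sum_congr rfl fun j _ => by rw [dist_comm]
  simp only [h1]
  simp only [degree_sup_edge hG huv hnadj, add_mul, Finset.sum_add_distrib, mul_add]
  have h3 := hT.sum_sum_degree_mul_dist
  simp only [mul_assoc, ← Finset.mul_sum] at h3
  rw [h3]
  simp only [hu, hT.sum_degree_mul_dist, ite_mul, one_mul, zero_mul, Finset.sum_ite_eq',
    Finset.mem_univ, if_true, dist_self, T.dist_comm (u := v) (v := u)]
  push_cast
  ring

open Classical in
theorem IsTree.sum_degree_sup_edge_mul (hT : T.IsTree) (hG : G = T ⊔ edge u v) (huv : u ≠ v) (hnadj : ¬ T.Adj u v)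
    (φ : ℝ → ℝ) :
    ∑ j, (G.degree j : ℝ) * φ (((T.dist j u : ℝ) - T.dist j v) / 2) =
      2 * ∑ j, φ (((T.dist j u : ℝ) - T.dist j v) / 2) := by
  rw [← hT.sum_degree_mul u v (fun x => φ (x / 2)) _ fun j => rfl]
  simp only [degree_sup_edge hG huv hnadj, add_mul, Finset.sum_add_distrib, ite_mul, one_mul,
    zero_mul, Finset.sum_ite_eq', Finset.mem_univ, if_true]
  ring

open Classical in
theorem IsTree.exists_isKemenyConstant_sub (hT : T.IsTree) [Nontrivial V] (hG : G = T ⊔ edge u v) (huv : u ≠ v)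
    (hnadj : ¬ T.Adj u v) :
    ∃ κT κG : ℝ≥0, IsKemenyConstant T.randomWalkMatrix κT ∧
      IsKemenyConstant G.randomWalkMatrix κG ∧
      4 * (Fintype.card V : ℝ) * (Fintype.card V - 1) * ((κG : ℝ) - κT) =
        -4 * ∑ i, ∑ j, (T.dist i j : ℝ) + 2 * (Fintype.card V - 1) * (2 * Fintype.card V - 1) +
        (Fintype.card V - 1) * (4 * ∑ i, ((T.dist i u : ℝ) + T.dist i v) -
          4 * (Fintype.card V - 1) + 2 * T.dist u v -
          4 / (T.dist u v + 1) * ∑ i, ∑ j,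
            (((T.dist i u : ℝ) - T.dist i v) / 2 - ((T.dist j u : ℝ) - T.dist j v) / 2) ^ 2) := by
  have hGc : G.Connected := hT.connected.mono (hG ▸ le_sup_left)
  obtain ⟨κT, hκT, hκT'⟩ := exists_isKemenyConstant hT.connected (fun i j => T.dist i j)
    (fun j => 2 - T.degree j) (by simp) hT.sum_adjMatrix_mul_dist_sub
  obtain ⟨a, ha⟩ := hT.sum_adjMatrix_sup_edge_mul hG huv hnadj
  obtain ⟨κG, hκG, hκG'⟩ := exists_isKemenyConstant hGc (fun j z => (T.dist j z -
    (((T.dist j u : ℝ) - T.dist j v) / 2 - ((T.dist z u : ℝ) - T.dist z v) / 2) ^ 2 /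
      (T.dist u v + 1))) a (by simp) ha
  refine ⟨κT, κG, hκT, hκG, ?_⟩
  set q : V → ℝ := fun j => ((T.dist j u : ℝ) - T.dist j v) / 2 with hq
  have hn : (1 : ℝ) < Fintype.card V := by exact_mod_cast Fintype.one_lt_card
  have hdG : ∑ i, (G.degree i : ℝ) = 2 * Fintype.card V := by
    have := hT.sum_degree_sup_edge_mul hG huv hnadj fun _ => 1
    simpa using this
  have hQ : ∑ i, ∑ j, (G.degree i : ℝ) * G.degree j * (q i - q j) ^ 2 =
      4 * ∑ i, ∑ j, (q i - q j) ^ 2 := by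
    have h1 : ∀ y : ℝ, ∑ j, (G.degree j : ℝ) * (y - q j) ^ 2 = 2 * ∑ j, (y - q j) ^ 2 := fun y =>
      hT.sum_degree_sup_edge_mul hG huv hnadj fun x => (y - x) ^ 2
    have h2 : ∑ i, (G.degree i : ℝ) * (2 * ∑ j, (q i - q j) ^ 2) =
        2 * ∑ i, 2 * ∑ j, (q i - q j) ^ 2 :=
      hT.sum_degree_sup_edge_mul hG huv hnadj fun y => 2 * ∑ j, (y - q j) ^ 2
    simp only [mul_assoc, ← Finset.mul_sum, h1]
    rw [h2, ← Finset.mul_sum]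
    ring
  have hκG2 : (κG : ℝ) = (4 * ∑ i, ∑ j, (T.dist i j : ℝ) -
      2 * (Fintype.card V - 1) * (2 * Fintype.card V - 1) +
        4 * ∑ i, ((T.dist i u : ℝ) + T.dist i v) - 4 * (Fintype.card V - 1) + 2 * T.dist u v
      - 4 / (T.dist u v + 1) * ∑ i, ∑ j, (q i - q j) ^ 2) / (4 * Fintype.card V) := by
    rw [hκG', hdG]
    simp only [mul_sub, Finset.sum_sub_distrib, hT.sum_sum_degree_sup_edge_mul_dist hG huv hnadj,
      ← mul_div_assoc, ← Finset.sum_div]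
    rw [hQ]
    congr 1 <;> ring
  have hn0 : (Fintype.card V : ℝ) ≠ 0 := by positivity
  have hn1 : (Fintype.card V : ℝ) - 1 ≠ 0 := by linarith
  have hS : ∑ i, ∑ j, (((T.dist i u : ℝ) - T.dist i v) / 2 -
      ((T.dist j u : ℝ) - T.dist j v) / 2) ^ 2 = ∑ i, ∑ j, (q i - q j) ^ 2 := rfl
  rw [hS, hκG2, hκT', hT.sum_degree, hT.sum_sum_degree_mul_dist]
  have hd : (T.dist u v : ℝ) + 1 ≠ 0 := by positivity
  field_simp
  ring

end SimpleGraph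

namespace SimpleGraph

variable {V : Type*} {T G : SimpleGraph V} {u v : V}

theorem IsTree.length_eq_dist (hT : T.IsTree) {p : T.Walk u v} (hp : p.IsPath) :
    p.length = T.dist u v := by
  obtain ⟨q, hq, hq'⟩ := hT.connected.exists_path_of_dist u v
  rw [← hq', (hT.existsUnique_path u v).unique hp hq]

theorem adj_of_mem_edges_of_ne (hG : G = T ⊔ edge u v) {x y : V} {p : G.Walk x y}
    (h : s(u, v) ∉ p.edges) {e : Sym2 V} (he : e ∈ p.edges) : e ∈ T.edgeSet := by
  have h1 := p.edges_subset_edgeSet he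
  induction e with | _ a b =>
  rw [mem_edgeSet, hG, sup_adj, edge_adj] at h1
  rcases h1 with h1 | ⟨⟨rfl, rfl⟩ | ⟨rfl, rfl⟩, _⟩
  · exact h1
  · exact absurd he h
  · exact absurd (Sym2.eq_swap ▸ he) h

theorem IsTree.length_of_isCycle_sup_edge (hT : T.IsTree) (hG : G = T ⊔ edge u v) (huv : u ≠ v)
    {x : V} {C : G.Walk x x} (hC : C.IsCycle) : C.length = T.dist u v + 1 := by
  classical
  have hmem : s(u, v) ∈ C.edges := by
    by_contra h
    exact hT.isAcyclic _ (hC.transfer (H := T) fun e he => adj_of_mem_edges_of_ne hG h he)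
  have hu := C.fst_mem_support_of_mem_edges hmem
  have hC' := hC.rotate hu
  have hmem' : s(u, v) ∈ (C.rotate u hu).edges := (C.rotate_edges u hu).mem_iff.mpr hmem
  rw [← C.length_rotate u hu]
  set C' := C.rotate u hu
  have hv : v ∈ C'.support := C'.snd_mem_support_of_mem_edges hmem'
  have happ := C'.take_spec hv
  have hp1 := hC'.isPath_takeUntil hv
  set p1 := C'.takeUntil v hv
  set p2 := C'.dropUntil v hv
  have hp2 : p2.IsPath := by
    refine Walk.IsCycle.isPath_of_append_right (p := p1) (fun h => huv h.eq) ?_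
    rwa [happ]
  have hnd := hC'.isCircuit.isTrail.edges_nodup
  rw [← happ, Walk.edges_append, List.nodup_append] at hnd
  rw [← happ, Walk.edges_append, List.mem_append] at hmem'
  rw [← happ, Walk.length_append]
  rcases hmem' with h | h
  · have h2 : s(u, v) ∉ p2.edges := fun h' => hnd.2.2 _ h _ h' rfl
    have := hT.length_eq_dist (hp2.transfer (H := T) fun e he => adj_of_mem_edges_of_ne hG h2 he)
    rw [Walk.length_transfer] at this
    rw [hp1.length_eq_one_of_mem_edges h, this, dist_comm, add_comm]
  · have h2 : s(u, v) ∉ p1.edges := fun h' => hnd.2.2 _ h' _ h rfl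
    have := hT.length_eq_dist (hp1.transfer (H := T) fun e he => adj_of_mem_edges_of_ne hG h2 he)
    rw [Walk.length_transfer] at this
    rw [hp2.length_eq_one_of_mem_edges (Sym2.eq_swap ▸ h), this]

end SimpleGraph

namespace SimpleGraph

variable {V : Type*} {T : SimpleGraph V} {u v : V}

/-- Along a sequence without backtracking, the distance to `z` keeps growing once it grows. -/
theorem IsTree.dist_eq_add_of_no_backtracking (hT : T.IsTree) {s : ℕ → V} {m : ℕ} {z : V}
    (hadj : ∀ i < m, T.Adj (s i) (s (i + 1))) (hne : ∀ i, i + 2 ≤ m → s i ≠ s (i + 2))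
    (h0 : 0 < m → T.dist (s 0) z ≤ T.dist (s 1) z) :
    ∀ i ≤ m, T.dist (s i) z = T.dist (s 0) z + i := by
  have hstep : ∀ i < m, T.dist (s (i + 1)) z = T.dist (s i) z + 1 := by
    intro i
    induction i with
    | zero =>
      intro hi
      have h1 := hT.dist_eq_dist_add_one_of_adj z (hadj 0 hi)
      rw [dist_comm, dist_comm (u := z)] at h1
      have := h0 hi
      simp only [zero_add] at h1 ⊢
      omega
    | succ i ih =>
      intro hi
      have h1 := hT.dist_eq_dist_add_one_of_adj z (hadj (i + 1) hi)
      rw [dist_comm, dist_comm (u := z)] at h1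
      rcases h1 with h1 | h1
      · have h2 := ih (by omega)
        have hz : s (i + 1) ≠ z := by
          intro h
          rw [h, dist_self] at h2
          omega
        obtain ⟨l, _, hl⟩ := hT.existsUnique_adj_dist hz
        have e1 := hl (s i) ⟨(hadj i (by omega)).symm, h2⟩
        have e2 := hl (s (i + 2)) ⟨hadj (i + 1) hi, h1⟩
        exact absurd (e1.trans e2.symm) (hne i (by omega))
      · exact h1
  intro i
  induction i with
  | zero => intro _; rfl
  | succ i ih =>
    intro hi
    rw [hstep i (by omega), ih (by omega), add_assoc]

/-- `s` traverses the path of length `d` from `u` to `v`, `π` is the projection to it, and `h` the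
distance to it. -/
structure IsPathProjection (T : SimpleGraph V) (u v : V) (d : ℕ) (s : ℕ → V) (π h : V → ℕ) :
    Prop where
  start : s 0 = u
  finish : s d = v
  proj_le : ∀ z, π z ≤ d
  dist_eq : ∀ z, ∀ a ≤ d, (T.dist (s a) z : ℝ) = h z + |(a : ℝ) - π z|

theorem IsTree.exists_isPathProjection (hT : T.IsTree) (u v : V) :
    ∃ s π h, IsPathProjection T u v (T.dist u v) s π h := by
  obtain ⟨p, hp, hd⟩ := hT.connected.exists_path_of_dist u v
  rw [← hd]
  have hadj : ∀ i < p.length, T.Adj (p.getVert i) (p.getVert (i + 1)) :=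
    fun i hi => p.adj_getVert_succ hi
  have hinj := hp.getVert_injOn
  have key : ∀ z, ∃ t ≤ p.length, ∀ a ≤ p.length,
      (T.dist (p.getVert a) z : ℝ) = T.dist (p.getVert t) z + |(a : ℝ) - t| := by
    intro z
    obtain ⟨t, ht, hmin⟩ := Finset.exists_min_image (Finset.range (p.length + 1))
      (fun a => T.dist (p.getVert a) z) ⟨0, by simp⟩
    have ht' : t ≤ p.length := by simpa [Nat.lt_succ_iff] using ht
    refine ⟨t, ht', fun a ha => ?_⟩
    rcases le_total t a with hta | hta
    · have := hT.dist_eq_add_of_no_backtracking (s := fun i => p.getVert (t + i))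
        (m := p.length - t) (z := z) (fun i hi => hadj (t + i) (by omega))
        (fun i hi h => by
          have := hinj (x₁ := t + i) (x₂ := t + (i + 2)) (by simp; omega) (by simp; omega) h
          omega)
        (fun h => hmin (t + 1) (by simp; omega)) (a - t) (by omega)
      simp only [Nat.add_sub_cancel' hta, add_zero] at this
      rw [this, abs_of_nonneg (by rw [sub_nonneg]; exact_mod_cast hta), Nat.cast_add,
        Nat.cast_sub hta]
    · have := hT.dist_eq_add_of_no_backtracking (s := fun i => p.getVert (t - i))
        (m := t) (z := z) (fun i hi => by
          have := (hadj (t - (i + 1)) (by omega)).symm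
          rwa [show t - (i + 1) + 1 = t - i by omega] at this)
        (fun i hi h => by
          have := hinj (x₁ := t - i) (x₂ := t - (i + 2)) (by simp; omega) (by simp; omega) h
          omega)
        (fun h => hmin (t - 1) (by simp; omega)) (t - a) (by omega)
      simp only [Nat.sub_sub_self hta, Nat.sub_zero] at this
      rw [this, abs_of_nonpos (by rw [sub_nonpos]; exact_mod_cast hta), Nat.cast_add,
        Nat.cast_sub hta, neg_sub]
  choose π hπ hdist using key
  exact ⟨p.getVert, π, fun z => T.dist (p.getVert (π z)) z, by simp, by simp, hπ, hdist⟩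

namespace IsPathProjection

variable {d : ℕ} {s : ℕ → V} {π h : V → ℕ}

theorem dist_start (H : IsPathProjection T u v d s π h) (z : V) :
    (T.dist z u : ℝ) = h z + π z := by
  have := H.dist_eq z 0 (Nat.zero_le _)
  rwa [H.start, Nat.cast_zero, zero_sub, abs_neg, Nat.abs_cast, dist_comm] at this

theorem dist_finish (H : IsPathProjection T u v d s π h) (z : V) :
    (T.dist z v : ℝ) = h z + (d - π z) := by
  have := H.dist_eq z d le_rfl
  rwa [H.finish, dist_comm, abs_of_nonneg] at this
  rw [sub_nonneg]
  exact_mod_cast H.proj_le z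

theorem height_proj (H : IsPathProjection T u v d s π h) {a : ℕ} (ha : a ≤ d) :
    h (s a) = 0 ∧ π (s a) = a := by
  have h1 := H.dist_eq (s a) a ha
  rw [dist_self, Nat.cast_zero] at h1
  have h2 := abs_nonneg ((a : ℝ) - π (s a))
  have h3 : (0 : ℝ) ≤ h (s a) := Nat.cast_nonneg _
  have h4 : |(a : ℝ) - π (s a)| = 0 := by linarith
  have h5 : (h (s a) : ℝ) = 0 := by linarith
  rw [abs_eq_zero, sub_eq_zero] at h4
  exact ⟨by exact_mod_cast h5, by exact_mod_cast h4.symm⟩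

theorem dist_proj (H : IsPathProjection T u v d s π h) (z : V) : T.dist (s (π z)) z = h z := by
  have := H.dist_eq z (π z) (H.proj_le z)
  rw [sub_self, abs_zero, add_zero] at this
  exact_mod_cast this

theorem injOn (H : IsPathProjection T u v d s π h) {a b : ℕ} (ha : a ≤ d) (hb : b ≤ d)
    (hab : s a = s b) : a = b := by
  rw [← (H.height_proj ha).2, hab, (H.height_proj hb).2]

theorem height_eq_zero_iff (H : IsPathProjection T u v d s π h) (hT : T.Connected) {z : V} :
    h z = 0 ↔ z = s (π z) := by
  rw [← H.dist_proj z, hT.dist_eq_zero_iff, eq_comm]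

theorem height_le_add_dist (H : IsPathProjection T u v d s π h) (hT : T.Connected) (i j : V) :
    h i ≤ h j + T.dist i j := by
  have h1 := H.dist_eq i (π j) (H.proj_le j)
  have h2 := abs_nonneg ((π j : ℝ) - π i)
  have h3 : h i ≤ T.dist (s (π j)) i := by
    have : (h i : ℝ) ≤ T.dist (s (π j)) i := by linarith
    exact_mod_cast this
  have h4 := hT.dist_triangle (u := s (π j)) (v := j) (w := i)
  rw [H.dist_proj, T.dist_comm (u := j)] at h4
  exact h3.trans h4

theorem exists_height_eq (H : IsPathProjection T u v d s π h) (hT : T.IsTree) {z : V} {k : ℕ}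
    (hk : k ≤ h z) : ∃ y, h y = k := by
  obtain ⟨m, hm⟩ := Nat.exists_eq_add_of_le hk
  induction m generalizing z with
  | zero => exact ⟨z, by omega⟩
  | succ m ih =>
    have hne : z ≠ s (π z) := fun hz => by
      rw [← H.height_eq_zero_iff hT.connected] at hz; omega
    obtain ⟨l, ⟨hl, hd⟩, _⟩ := hT.existsUnique_adj_dist hne
    have h1 := H.height_le_add_dist hT.connected l (s (π z))
    rw [(H.height_proj (H.proj_le z)).1] at h1
    have h2 := H.height_le_add_dist hT.connected z l
    rw [dist_eq_one_iff_adj.mpr hl] at h2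
    rw [T.dist_comm, H.dist_proj] at hd
    exact ih (z := l) (by omega) (by omega)

end IsPathProjection

end SimpleGraph

theorem sum_range_abs_sub {d t : ℕ} (ht : t ≤ d) :
    ∑ a ∈ Finset.range (d + 1), |(a : ℝ) - t| = ((t : ℝ) - d / 2) ^ 2 + d ^ 2 / 4 + d / 2 := by
  have h1 : ∀ m ≤ t + 1, ∑ a ∈ Finset.range m, |(a : ℝ) - t| = m * t - m * (m - 1) / 2 := by
    intro m
    induction m with
    | zero => simp
    | succ m ih =>
      intro hm
      have : (m : ℝ) ≤ t := by exact_mod_cast Nat.le_of_succ_le_succ hm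
      rw [Finset.sum_range_succ, ih (by omega), abs_of_nonpos (by linarith)]
      push_cast
      ring
  induction d, ht using Nat.le_induction with
  | base =>
    rw [h1 _ le_rfl]
    push_cast
    ring
  | succ d hd ih =>
    have : (t : ℝ) ≤ d := by exact_mod_cast hd
    rw [Finset.sum_range_succ, ih]
    push_cast
    rw [abs_of_nonneg (by linarith)]
    ring

theorem sum_range_sub_sq (d : ℕ) (t : ℝ) :
    ∑ a ∈ Finset.range (d + 1), ((a : ℝ) - t) ^ 2 =
      (d + 1) * (t - d / 2) ^ 2 + (d + 1) * ((d + 1) ^ 2 - 1) / 12 := by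
  induction d with
  | zero => simp
  | succ d ih =>
    rw [Finset.sum_range_succ, ih]
    push_cast
    ring

theorem sum_fin_sum_fin_min (N : ℕ) :
    ∑ k : Fin N, ∑ l : Fin N, (if k = l then (0 : ℝ) else (min (k : ℕ) l : ℕ) + 1) =
      N * (N - 1) * (N + 1) / 3 := by
  induction N with
  | zero => simp
  | succ N ih =>
    have h1 : ∀ k : Fin N, (min (k : ℕ) N : ℕ) = k := fun k => min_eq_left k.2.le
    have h2 : ∑ k : Fin N, ((k : ℝ) + 1) = N * (N + 1) / 2 := by
      rw [Fin.sum_univ_eq_sum_range (fun k => (k : ℝ) + 1)]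
      clear ih h1
      induction N with
      | zero => simp
      | succ N ih =>
        rw [Finset.sum_range_succ, ih]
        push_cast
        ring
    have h3 : ∀ k : Fin N, Fin.last N ≠ k.castSucc := fun k => (Fin.castSucc_lt_last k).ne'
    rw [Fin.sum_univ_castSucc]
    simp only [Fin.sum_univ_castSucc, Fin.castSucc_inj, Finset.sum_add_distrib, Fin.val_castSucc,
      Fin.val_last, h1, min_comm N, if_neg (h3 _), if_neg (h3 _).symm, ih, if_true]
    simp only [← Finset.sum_add_distrib, h2]
    push_cast
    ring

/-- The minimal value of `(t - d / 2) ^ 2` over integers `t`. -/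
theorem mod_two_div_four_le (d t : ℕ) : ((d % 2 : ℕ) : ℝ) / 4 ≤ ((t : ℝ) - d / 2) ^ 2 ∧
    (((t : ℝ) - d / 2) ^ 2 = ((d % 2 : ℕ) : ℝ) / 4 ↔
      t + 1 = (d + 1 + 1) / 2 ∨ t + 1 = (d + 1 + 2) / 2) := by
  rcases Nat.even_or_odd' d with ⟨m, rfl | rfl⟩
  · have e : (2 * m) % 2 = 0 := by omega
    rw [e]
    push_cast
    refine ⟨by rw [zero_div]; exact sq_nonneg _, ?_⟩
    rw [show (2 * m + 1 + 1) / 2 = m + 1 by omega, show (2 * m + 1 + 2) / 2 = m + 1 by omega, or_self,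
      zero_div, sq_eq_zero_iff, mul_div_cancel_left₀ _ two_ne_zero, sub_eq_zero, Nat.cast_inj]
    omega
  · have e : (2 * m + 1) % 2 = 1 := by omega
    rw [e, show (2 * m + 1 + 1 + 1) / 2 = m + 1 by omega,
      show (2 * m + 1 + 1 + 2) / 2 = m + 2 by omega]
    have h1 : ((t : ℝ) - (2 * m + 1 : ℕ) / 2) ^ 2 = ((t : ℝ) - m) * (t - m - 1) + 1 / 4 := by
      push_cast; ring
    rw [h1]
    push_cast
    constructor
    · rcases le_or_gt t m with h | h
      · have : (t : ℝ) ≤ m := by exact_mod_cast h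
        nlinarith
      · have : (m : ℝ) + 1 ≤ t := by exact_mod_cast h
        nlinarith
    · rw [add_eq_right, mul_eq_zero, sub_eq_zero, sub_sub, sub_eq_zero]
      norm_cast

theorem floor_mul_ceil_half (d : ℕ) :
    (⌊((d + 1 : ℕ) + 1 : ℝ) / 2⌋ : ℝ) * ⌈((d + 1 : ℕ) + 1 : ℝ) / 2⌉ =
      ((d : ℝ) + 2) ^ 2 / 4 - ((d % 2 : ℕ) : ℝ) / 4 := by
  rcases Nat.even_or_odd' d with ⟨m, rfl | rfl⟩
  · have h : (((2 * m + 1 : ℕ) : ℝ) + 1) / 2 = ((m + 1 : ℤ) : ℝ) := by push_cast; ring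
    rw [h, Int.floor_intCast, Int.ceil_intCast, Nat.mul_mod_right]
    push_cast
    ring
  · have h1 : ⌊(((2 * m + 1 + 1 : ℕ) : ℝ) + 1) / 2⌋ = m + 1 := by
      rw [Int.floor_eq_iff]; push_cast; constructor <;> linarith
    have h2 : ⌈(((2 * m + 1 + 1 : ℕ) : ℝ) + 1) / 2⌉ = m + 2 := by
      rw [Int.ceil_eq_iff]; push_cast; constructor <;> linarith
    rw [h1, h2, show (2 * m + 1) % 2 = 1 by omega]
    push_cast
    ring

namespace SimpleGraph

variable {V : Type*} {T : SimpleGraph V} {u v : V}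

/-- `x` enumerates the vertices off the path. -/
def IsEnumeration (h : V → ℕ) {N : ℕ} (x : Fin N → V) : Prop :=
  Function.Injective x ∧ ∀ z, z ∈ Set.range x ↔ 0 < h z

namespace IsPathProjection

variable {d : ℕ} {s : ℕ → V} {π h : V → ℕ}

variable [Fintype V]

theorem sum_eq (H : IsPathProjection T u v d s π h) (hT : T.Connected) {N : ℕ} {x : Fin N → V}
    (hx : IsEnumeration h x) (φ : V → ℝ) :
    ∑ z, φ z = ∑ a ∈ Finset.range (d + 1), φ (s a) + ∑ k, φ (x k) := by
  classical
  rw [← Finset.sum_filter_add_sum_filter_not Finset.univ (fun z => h z = 0)]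
  congr 1
  · rw [← Finset.sum_image (f := φ) (g := s) (s := Finset.range (d + 1))]
    · congr 1
      ext z
      simp only [Finset.mem_filter, Finset.mem_univ, true_and, Finset.mem_image, Finset.mem_range]
      constructor
      · intro hz
        exact ⟨π z, Nat.lt_succ_of_le (H.proj_le z), ((H.height_eq_zero_iff hT).mp hz).symm⟩
      · rintro ⟨a, ha, rfl⟩
        exact (H.height_proj (Nat.le_of_lt_succ ha)).1
    · intro a ha b hb hab
      simp only [Finset.coe_range, Set.mem_Iio] at ha hb
      exact H.injOn (by omega) (by omega) hab
  · rw [← Finset.sum_image (f := φ) (g := x) (s := Finset.univ) hx.1.injOn]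
    congr 1
    ext z
    have := hx.2 z
    simp only [Set.mem_range] at this
    simp only [Finset.mem_filter, Finset.mem_univ, true_and, Finset.mem_image, this]
    omega

theorem card_eq (H : IsPathProjection T u v d s π h) (hT : T.Connected) {N : ℕ} {x : Fin N → V}
    (hx : IsEnumeration h x) : Fintype.card V = d + 1 + N := by
  have := H.sum_eq hT hx fun _ => 1
  simp only [Finset.sum_const, Finset.card_univ, Finset.card_range, Fintype.card_fin, nsmul_eq_mul,
    mul_one] at this
  exact_mod_cast this

/-- The distance from the bound, as a sum over the vertices off the path. -/
theorem kemenyIncreaseBound_sub (H : IsPathProjection T u v d s π h) (hT : T.Connected) {N : ℕ}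
    {x : Fin N → V} (hx : IsEnumeration h x) (hd : 1 ≤ d) {n : ℕ} (hn : Fintype.card V = n) :
    4 * (n : ℝ) * (n - 1) * kemenyIncreaseBound n (d + 1) -
      (-4 * ∑ i, ∑ j, (T.dist i j : ℝ) + 2 * (n - 1) * (2 * n - 1) +
        (n - 1) * (4 * ∑ i, ((T.dist i u : ℝ) + T.dist i v) - 4 * (n - 1) + 2 * d -
          4 / (d + 1) * ∑ i, ∑ j,
            (((T.dist i u : ℝ) - T.dist i v) / 2 - ((T.dist j u : ℝ) - T.dist j v) / 2) ^ 2)) =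
      8 * n * ∑ k, (((π (x k) : ℝ) - d / 2) ^ 2 - ((d % 2 : ℕ) : ℝ) / 4) +
      4 * ∑ k, ∑ l, if k = l then 0 else (T.dist (x k) (x l) +
        (n - 1) / (d + 1) * ((π (x k) : ℝ) - π (x l)) ^ 2 - h (x k) - h (x l) +
          2 * ((min (k : ℕ) l : ℕ) + 1)) := by
  have hnN : (n : ℝ) = d + 1 + N := by
    rw [← hn, H.card_eq hT hx]; push_cast; ring
  have hd1 : (1 : ℝ) ≤ d := by exact_mod_cast hd
  have hd0 : (d : ℝ) + 1 ≠ 0 := by positivity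
  have hn0 : (n : ℝ) ≠ 0 := by rw [hnN]; positivity
  have hn1 : (n : ℝ) - 1 ≠ 0 := by
    have : (0 : ℝ) ≤ N := Nat.cast_nonneg _
    rw [hnN]
    intro h
    linarith
  set g : V → V → ℝ := fun i j =>
    T.dist i j + (n - 1) / (d + 1) * ((π i : ℝ) - π j) ^ 2 with hg
  set G : V → ℝ := fun j =>
    n * ((π j : ℝ) - d / 2) ^ 2 + (n + 2) * ((d + 1) ^ 2 - 1) / 12 with hG
  have hgsymm : ∀ i j, g i j = g j i := fun i j => by
    simp only [hg]; rw [dist_comm]; ring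
  have hrow : ∀ j, ∑ a ∈ Finset.range (d + 1), g (s a) j = (d + 1) * h j + G j := by
    intro j
    have h1 : ∀ a ∈ Finset.range (d + 1), g (s a) j =
        h j + |(a : ℝ) - π j| + (n - 1) / (d + 1) * ((a : ℝ) - π j) ^ 2 := by
      intro a ha
      have ha' := Nat.le_of_lt_succ (Finset.mem_range.mp ha)
      simp only [hg]
      rw [H.dist_eq j a ha', (H.height_proj ha').2]
    rw [Finset.sum_congr rfl h1, Finset.sum_add_distrib, Finset.sum_add_distrib, ← Finset.mul_sum,
      sum_range_abs_sub (H.proj_le j), sum_range_sub_sq]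
    simp only [Finset.sum_const, Finset.card_range, nsmul_eq_mul, hG]
    push_cast
    field_simp
    ring
  have hpath : ∑ a ∈ Finset.range (d + 1), ((d + 1) * (h (s a) : ℝ) + G (s a)) =
      (n + 1) * (d + 1) * ((d + 1) ^ 2 - 1) / 6 := by
    have h1 : ∀ a ∈ Finset.range (d + 1), (d + 1) * (h (s a) : ℝ) + G (s a) =
        n * ((a : ℝ) - d / 2) ^ 2 + (n + 2) * ((d + 1) ^ 2 - 1) / 12 := by
      intro a ha
      have ha' := Nat.le_of_lt_succ (Finset.mem_range.mp ha)
      simp only [hG]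
      rw [(H.height_proj ha').1, (H.height_proj ha').2]
      simp
    rw [Finset.sum_congr rfl h1, Finset.sum_add_distrib, ← Finset.mul_sum, sum_range_sub_sq]
    simp only [Finset.sum_const, Finset.card_range, nsmul_eq_mul]
    push_cast
    ring
  have hgsum : ∑ i, ∑ j, g i j = (n + 1) * (d + 1) * ((d + 1) ^ 2 - 1) / 6 +
      2 * ∑ k, ((d + 1) * (h (x k) : ℝ) + G (x k)) + ∑ k, ∑ l, g (x k) (x l) := by
    have h1 : ∀ i, ∑ j, g i j = ((d + 1) * (h i : ℝ) + G i) + ∑ l, g i (x l) := by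
      intro i
      rw [H.sum_eq hT hx, ← hrow i]
      simp only [hgsymm i]
    simp only [h1]
    rw [Finset.sum_add_distrib, H.sum_eq hT hx, hpath,
      Finset.sum_comm (f := fun i l => g i (x l))]
    have h2 : ∀ l, ∑ i, g i (x l) =
        ((d + 1) * (h (x l) : ℝ) + G (x l)) + ∑ k, g (x k) (x l) := by
      intro l
      rw [H.sum_eq hT hx, hrow]
    rw [Finset.sum_congr rfl fun l _ => h2 l,
      Finset.sum_add_distrib (f := fun l => (d + 1) * (h (x l) : ℝ) + G (x l))]
    rw [Finset.sum_comm (f := fun k l => g (x l) (x k))]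
    ring
  have hoff : ∑ k, ∑ l, (if k = l then 0 else (T.dist (x k) (x l) +
        (n - 1) / (d + 1) * ((π (x k) : ℝ) - π (x l)) ^ 2 - h (x k) - h (x l) +
          2 * ((min (k : ℕ) l : ℕ) + 1))) = ∑ k, ∑ l, g (x k) (x l) -
        2 * (N - 1) * ∑ k, (h (x k) : ℝ) + 2 * (N * (N - 1) * (N + 1) / 3) := by
    have h1 : ∀ k l, (if k = l then 0 else (T.dist (x k) (x l) +
        (n - 1) / (d + 1) * ((π (x k) : ℝ) - π (x l)) ^ 2 - h (x k) - h (x l) +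
          2 * ((min (k : ℕ) l : ℕ) + 1))) = g (x k) (x l) - h (x k) - h (x l) +
        2 * (if k = l then (0 : ℝ) else (min (k : ℕ) l : ℕ) + 1) +
        if k = l then 2 * (h (x k) : ℝ) else 0 := by
      intro k l
      rcases eq_or_ne k l with rfl | hkl
      · simp [hg]; ring
      · simp only [if_neg hkl, hg]; ring
    simp only [h1, Finset.sum_add_distrib, Finset.sum_sub_distrib, ← Finset.mul_sum,
      sum_fin_sum_fin_min, Finset.sum_ite_eq, Finset.mem_univ, if_true, Finset.sum_const,
      Finset.card_univ, Fintype.card_fin, nsmul_eq_mul]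
    ring
  have hH : ∑ i, ((T.dist i u : ℝ) + T.dist i v) = 2 * ∑ k, (h (x k) : ℝ) + n * d := by
    have h1 : ∀ i, ((T.dist i u : ℝ) + T.dist i v) = 2 * h i + d := fun i => by
      rw [H.dist_start, H.dist_finish]; ring
    simp only [h1, Finset.sum_add_distrib, ← Finset.mul_sum]
    rw [H.sum_eq hT hx fun i => (h i : ℝ)]
    have h2 : ∑ a ∈ Finset.range (d + 1), (h (s a) : ℝ) = 0 := Finset.sum_eq_zero fun a ha => by
      rw [(H.height_proj (Nat.le_of_lt_succ (Finset.mem_range.mp ha))).1, Nat.cast_zero]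
    rw [h2]
    simp [hn]
  have hQ : ∑ i, ∑ j,
      (((T.dist i u : ℝ) - T.dist i v) / 2 - ((T.dist j u : ℝ) - T.dist j v) / 2) ^ 2 =
      ∑ i, ∑ j, ((π i : ℝ) - π j) ^ 2 := by
    refine Finset.sum_congr rfl fun i _ => Finset.sum_congr rfl fun j _ => ?_
    rw [H.dist_start, H.dist_finish, H.dist_start, H.dist_finish]
    ring
  have hgQ : ∑ i, ∑ j, g i j = ∑ i, ∑ j, (T.dist i j : ℝ) +
      (n - 1) / (d + 1) * ∑ i, ∑ j, ((π i : ℝ) - π j) ^ 2 := by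
    simp only [hg, Finset.sum_add_distrib, ← Finset.mul_sum]
  have hGsum : ∑ k, ((d + 1) * (h (x k) : ℝ) + G (x k)) = (d + 1) * ∑ k, (h (x k) : ℝ) +
      n * ∑ k, ((π (x k) : ℝ) - d / 2) ^ 2 + N * ((n + 2) * ((d + 1) ^ 2 - 1) / 12) := by
    simp only [hG, Finset.sum_add_distrib, ← Finset.mul_sum]
    simp
    ring
  rw [hoff, hH, hQ, Finset.sum_sub_distrib, kemenyIncreaseBound, mul_assoc (n * (_ : ℝ)) _ _,
    floor_mul_ceil_half]
  rw [hgQ, hGsum] at hgsum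
  simp only [Finset.sum_const, Finset.card_univ, Fintype.card_fin, nsmul_eq_mul]
  generalize ∑ k, ∑ l, g (x k) (x l) = A at *
  generalize ∑ k, (h (x k) : ℝ) = B at *
  generalize ∑ k, ((π (x k) : ℝ) - d / 2) ^ 2 = C at *
  generalize ((d % 2 : ℕ) : ℝ) = e at *
  have hA : A = ∑ i, ∑ j, (T.dist i j : ℝ) +
      (n - 1) / (d + 1) * ∑ i, ∑ j, ((π i : ℝ) - π j) ^ 2 -
      ((n + 1) * (d + 1) * ((d + 1) ^ 2 - 1) / 6 +
      2 * ((d + 1) * B + n * C + N * ((n + 2) * ((d + 1) ^ 2 - 1) / 12))) := by linarith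
  have hN : (N : ℝ) = n - d - 1 := by linarith
  rw [hA, hN]
  push_cast
  field_simp
  ring

end IsPathProjection

end SimpleGraph

namespace SimpleGraph

variable {V : Type*} {T : SimpleGraph V} {u v : V}

theorem IsTree.dist_embedding_eq_add (hT : T.IsTree) {m : ℕ} {e : Fin m ↪ V}
    (he : (pathGraph m).map e ≤ T) {z : V} {a : Fin m}
    (h0 : ∀ b : Fin m, (b : ℕ) = a + 1 → T.dist (e a) z ≤ T.dist (e b) z) {b : Fin m}
    (hab : a ≤ b) : T.dist (e b) z = T.dist (e a) z + (b - a : ℕ) := by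
  have hadj : ∀ i j : Fin m, (j : ℕ) = i + 1 → T.Adj (e i) (e j) := fun i j hij =>
    he ((map_adj _ _ _ _).mpr ⟨i, j, pathGraph_adj.mpr (Or.inl hij.symm), rfl, rfl⟩)
  set t : ℕ → V := fun i => if h : a + i < m then e ⟨a + i, h⟩ else e a with ht
  have ht' : ∀ i (h : a + i < m), t i = e ⟨a + i, h⟩ := fun i h => by simp only [ht, dif_pos h]
  have hab' : (a : ℕ) ≤ b := hab
  have hb := b.2
  have key := hT.dist_eq_add_of_no_backtracking (s := t) (m := b - a) (z := z)
    (fun i hi => by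
      rw [ht' i (by omega), ht' (i + 1) (by omega)]
      exact hadj _ _ (by simp only; omega))
    (fun i hi h => by
      rw [ht' i (by omega), ht' (i + 2) (by omega)] at h
      have := Fin.val_eq_of_eq (e.injective h)
      simp only at this
      omega)
    (fun h => by
      rw [ht' 0 (by omega), ht' 1 (by omega)]
      exact h0 _ rfl) (b - a) le_rfl
  rw [ht' 0 (by omega), ht' (b - a) (by omega)] at key
  have e1 : (⟨a + (b - a), by omega⟩ : Fin m) = b := Fin.ext (by simp only; omega)
  rw [e1] at key
  exact key

theorem IsTree.dist_embedding (hT : T.IsTree) {m : ℕ} {e : Fin m ↪ V}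
    (he : (pathGraph m).map e ≤ T) (a b : Fin m) :
    (T.dist (e a) (e b) : ℝ) = |(a : ℝ) - b| := by
  wlog hab : a ≤ b generalizing a b
  · rw [dist_comm, abs_sub_comm]
    exact this b a (le_of_not_ge hab)
  · have hab' : (a : ℕ) ≤ b := hab
    rw [dist_comm, hT.dist_embedding_eq_add he (fun _ _ => by rw [dist_self]; exact zero_le) hab,
      dist_self, zero_add, Nat.cast_sub hab', abs_sub_comm, abs_of_nonneg]
    rw [sub_nonneg]
    exact_mod_cast hab'

/-- Distances in a path with another path attached at one of its vertices. -/
theorem IsTree.dist_attached_path (hT : T.IsTree) {m M : ℕ} {f : Fin m ↪ V} {g : Fin (M + 1) ↪ V}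
    (hf : (pathGraph m).map f ≤ T) (hg : (pathGraph (M + 1)).map g ≤ T) {i : Fin m}
    (h0 : g 0 = f i) (hfg : Set.range f ∩ Set.range g = {f i}) (k : Fin (M + 1)) (b : Fin m) :
    (T.dist (g k) (f b) : ℝ) = k + |(i : ℝ) - b| := by
  have h := hT.dist_embedding_eq_add hg (z := f b) (a := 0) (b := k) (fun l hl => by
    by_contra! hlt
    rw [h0] at hlt
    have hadj : T.Adj (f i) (g l) := by
      rw [← h0]
      exact hg ((map_adj _ _ _ _).mpr ⟨0, l, pathGraph_adj.mpr (Or.inl hl.symm), rfl, rfl⟩)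
    have hd : T.dist (f i) (f b) = T.dist (g l) (f b) + 1 := by
      have h1 := hT.dist_eq_dist_add_one_of_adj (f b) hadj
      rw [dist_comm, dist_comm (u := f b)] at h1
      omega
    have hib : i ≠ b := fun h => by rw [h, dist_self] at hd; omega
    obtain ⟨y, -, hy⟩ := hT.existsUnique_adj_dist (f.injective.ne hib)
    have hstep : ∃ j : Fin m, (pathGraph m).Adj i j ∧ |(i : ℝ) - b| = |(j : ℝ) - b| + 1 := by
      have := i.2
      have := b.2
      rcases lt_or_gt_of_ne hib with hlt | hlt
      · have hlt' : (i : ℕ) < b := hlt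
        have : (i : ℝ) + 1 ≤ b := by exact_mod_cast hlt'
        refine ⟨⟨i + 1, by omega⟩, pathGraph_adj.mpr (Or.inl rfl), ?_⟩
        push_cast
        rw [abs_of_nonpos (by linarith), abs_of_nonpos (by linarith)]
        ring
      · have hlt' : (b : ℕ) < i := hlt
        have : (b : ℝ) + 1 ≤ i := by exact_mod_cast hlt'
        refine ⟨⟨i - 1, by omega⟩, pathGraph_adj.mpr (Or.inr (by simp only; omega)), ?_⟩
        rw [Nat.cast_sub (by omega), Nat.cast_one, abs_of_nonneg (by linarith),
          abs_of_nonneg (by linarith)]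
        ring
    obtain ⟨j, hij, hj⟩ := hstep
    have e1 := hy (g l) ⟨hadj, hd⟩
    have e2 := hy (f j) ⟨hf ((map_adj _ _ _ _).mpr ⟨i, j, hij, rfl, rfl⟩), by
      rw [← hT.dist_embedding hf, ← hT.dist_embedding hf] at hj
      exact_mod_cast hj⟩
    have hmem : g l ∈ Set.range f ∩ Set.range g := ⟨⟨j, e2.trans e1.symm⟩, ⟨l, rfl⟩⟩
    rw [hfg, Set.mem_singleton_iff, ← h0] at hmem
    have := Fin.val_eq_of_eq (g.injective hmem)
    rw [hl] at this
    simp at this) (Fin.zero_le k)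
  rw [h, Nat.cast_add, h0, hT.dist_embedding hf, Fin.val_zero, Nat.sub_zero, add_comm]

variable [Fintype V]

namespace IsPathProjection

variable {d : ℕ} {s : ℕ → V} {π h : V → ℕ}

theorem exists_enumeration (H : IsPathProjection T u v d s π h) (hT : T.IsTree) :
    ∃ (N : ℕ) (x : Fin N → V), IsEnumeration h x ∧ Monotone (h ∘ x) ∧
      ∀ k, h (x k) ≤ k + 1 := by
  classical
  set X : Finset V := Finset.univ.filter fun z => 0 < h z
  set y : Fin X.card → V := fun k => X.equivFin.symm k with hy
  have hyinj : Function.Injective y := Subtype.val_injective.comp X.equivFin.symm.injective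
  have hyrange : ∀ z, z ∈ Set.range y ↔ 0 < h z := by
    intro z
    constructor
    · rintro ⟨k, rfl⟩
      exact (Finset.mem_filter.mp (X.equivFin.symm k).2).2
    · intro hz
      exact ⟨X.equivFin ⟨z, by simp [X, hz]⟩, by simp [hy]⟩
  set x := y ∘ Tuple.sort (h ∘ y) with hx
  have hmono : Monotone (h ∘ x) := Tuple.monotone_sort (h ∘ y)
  have henum : IsEnumeration h x := by
    refine ⟨hyinj.comp (Tuple.sort (h ∘ y)).injective, fun z => ?_⟩
    rw [hx, (Tuple.sort (h ∘ y)).surjective.range_comp]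
    exact hyrange z
  refine ⟨X.card, x, henum, hmono, fun k => ?_⟩
  have hsub : Finset.Ico 1 (h (x k)) ⊆ (Finset.Iio k).image (h ∘ x) := by
    intro t ht
    rw [Finset.mem_Ico] at ht
    obtain ⟨z, hz⟩ := H.exists_height_eq hT ht.2.le
    obtain ⟨l, hl⟩ := (henum.2 z).mpr (by omega)
    refine Finset.mem_image.mpr ⟨l, ?_, by rw [Function.comp_apply, hl, hz]⟩
    rw [Finset.mem_Iio]
    by_contra hkl
    have : h (x k) ≤ h (x l) := hmono (not_lt.mp hkl)
    rw [hl, hz] at this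
    omega
  have := (Finset.card_le_card hsub).trans Finset.card_image_le
  rw [Nat.card_Ico, Fin.card_Iio] at this
  omega

omit [Fintype V] in
/-- The contribution of a pair of vertices off the path to the distance from the bound. -/
theorem pair_nonneg (H : IsPathProjection T u v d s π h) (hT : T.Connected) {N : ℕ}
    {x : Fin N → V} (hle : ∀ k, h (x k) ≤ k + 1) {r : ℝ} (hr : 0 < r) (k l : Fin N) :
    0 ≤ T.dist (x k) (x l) + r * ((π (x k) : ℝ) - π (x l)) ^ 2 - h (x k) - h (x l) +
      2 * ((min (k : ℕ) l : ℕ) + 1) ∧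
    (T.dist (x k) (x l) + r * ((π (x k) : ℝ) - π (x l)) ^ 2 - h (x k) - h (x l) +
      2 * ((min (k : ℕ) l : ℕ) + 1) = 0 → π (x k) = π (x l) ∧
        (T.dist (x k) (x l) : ℝ) = |(h (x k) : ℝ) - h (x l)|) := by
  have h1 : (h (x k) : ℝ) ≤ h (x l) + T.dist (x k) (x l) := by
    exact_mod_cast H.height_le_add_dist hT _ _
  have h2 : (h (x l) : ℝ) ≤ h (x k) + T.dist (x k) (x l) := by
    rw [dist_comm]
    exact_mod_cast H.height_le_add_dist hT _ _
  have h3 : |(h (x k) : ℝ) - h (x l)| ≤ T.dist (x k) (x l) := abs_le.mpr ⟨by linarith, by linarith⟩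
  have h4 : (h (x k) : ℝ) + h (x l) - |(h (x k) : ℝ) - h (x l)| ≤
      2 * ((min (k : ℕ) l : ℕ) + 1) := by
    rcases le_total (k : ℕ) l with hkl | hkl
    · rw [min_eq_left hkl]
      have : (h (x k) : ℝ) ≤ k + 1 := by exact_mod_cast hle k
      linarith [neg_le_abs ((h (x k) : ℝ) - h (x l))]
    · rw [min_eq_right hkl]
      have : (h (x l) : ℝ) ≤ l + 1 := by exact_mod_cast hle l
      linarith [le_abs_self ((h (x k) : ℝ) - h (x l))]
  have h5 : 0 ≤ r * ((π (x k) : ℝ) - π (x l)) ^ 2 := by positivity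
  refine ⟨by linarith, fun h0 => ⟨?_, by linarith⟩⟩
  have h6 : r * ((π (x k) : ℝ) - π (x l)) ^ 2 = 0 := by linarith
  rw [mul_eq_zero, or_iff_right hr.ne', sq_eq_zero_iff, sub_eq_zero] at h6
  exact_mod_cast h6

theorem isTShaped (H : IsPathProjection T u v d s π h) (hT : T.Connected) {N : ℕ} {x : Fin N → V}
    (hx : IsEnumeration h x) (hmono : Monotone (h ∘ x)) (hle : ∀ k, h (x k) ≤ k + 1)
    (hmid : ∀ k, π (x k) + 1 = (d + 1 + 1) / 2 ∨ π (x k) + 1 = (d + 1 + 2) / 2)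
    (hpair : ∀ k l, k ≠ l → π (x k) = π (x l) ∧
      (T.dist (x k) (x l) : ℝ) = |(h (x k) : ℝ) - h (x l)|) :
    T.IsTShaped u v (d + 1) := by
  obtain rfl : N = Fintype.card V - (d + 1) := by rw [H.card_eq hT hx]; omega
  have hstrict : StrictMono (h ∘ x) := by
    refine hmono.strictMono_of_injective fun k l hkl => ?_
    by_contra hne
    have h1 := (hpair k l hne).2
    simp only [Function.comp_apply] at hkl
    rw [hkl, sub_self, abs_zero, Nat.cast_eq_zero, hT.dist_eq_zero_iff] at h1
    exact hne (hx.1 h1)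
  have hheight : ∀ k, h (x k) = k + 1 := by
    rintro ⟨k, hk⟩
    refine le_antisymm (hle _) ?_
    induction k with
    | zero =>
      have := (hx.2 _).mp ⟨⟨0, hk⟩, rfl⟩
      simp only
      omega
    | succ k ih =>
      have h1 := ih (by omega)
      have h2 : h (x ⟨k, by omega⟩) < h (x ⟨k + 1, hk⟩) := hstrict (by simp)
      simp only at h1 ⊢
      omega
  obtain ⟨i, hid, himid, hi⟩ : ∃ i ≤ d, (i + 1 = (d + 1 + 1) / 2 ∨ i + 1 = (d + 1 + 2) / 2) ∧
      ∀ k, π (x k) = i := by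
    rcases isEmpty_or_nonempty (Fin (Fintype.card V - (d + 1))) with _ | ⟨⟨l⟩⟩
    · exact ⟨d / 2, by omega, by omega, isEmptyElim⟩
    · refine ⟨π (x l), H.proj_le _, hmid l, fun k => ?_⟩
      rcases eq_or_ne k l with rfl | hk
      · rfl
      · exact (hpair k l hk).1
  have hnot : s i ∉ Set.range x := by
    rw [hx.2, (H.height_proj hid).1]
    exact lt_irrefl 0
  let f : Fin (d + 1) ↪ V := ⟨fun a => s a, fun a b hab =>
    Fin.ext (H.injOn (Nat.le_of_lt_succ a.2) (Nat.le_of_lt_succ b.2) hab)⟩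
  let g : Fin (Fintype.card V - (d + 1) + 1) ↪ V := ⟨Fin.cons (s i) x, Fin.cons_injective_iff.mpr ⟨hnot, hx.1⟩⟩
  have hff : ∀ a b : Fin (d + 1), (T.dist (f a) (f b) : ℝ) = |(a : ℝ) - b| := by
    intro a b
    change (T.dist (s a) (s b) : ℝ) = _
    have hb := H.height_proj (Nat.le_of_lt_succ b.2)
    rw [H.dist_eq _ _ (Nat.le_of_lt_succ a.2), hb.1, hb.2, Nat.cast_zero, zero_add]
  have hg0 : g 0 = f ⟨i, Nat.lt_succ_of_le hid⟩ := rfl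
  have hfg : ∀ (a : Fin (d + 1)) (p : Fin (Fintype.card V - (d + 1) + 1)),
      (T.dist (f a) (g p) : ℝ) = p + |(a : ℝ) - i| := by
    intro a p
    induction p using Fin.cases with
    | zero => rw [hg0, hff]; simp
    | succ k =>
      change (T.dist (s a) (x k) : ℝ) = _
      rw [H.dist_eq _ _ (Nat.le_of_lt_succ a.2), hi, hheight, Fin.val_succ]
  have hgg : ∀ p q : Fin (Fintype.card V - (d + 1) + 1), (T.dist (g p) (g q) : ℝ) = |(p : ℝ) - q| := by
    intro p q
    induction p using Fin.cases with
    | zero => rw [hg0, hfg]; simp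
    | succ k =>
      induction q using Fin.cases with
      | zero =>
        rw [hg0, dist_comm, hfg]
        simp only [Fin.val_succ, sub_self, abs_zero, Fin.val_zero, Nat.cast_zero, sub_zero,
          Nat.abs_cast, add_zero]
      | succ l =>
        rcases eq_or_ne k l with rfl | hkl
        · simp
        · change (T.dist (x k) (x l) : ℝ) = _
          rw [(hpair k l hkl).2, hheight, hheight, Fin.val_succ, Fin.val_succ]
  have hcover : ∀ z, z ∈ Set.range f ∪ Set.range g := by
    intro z
    rcases Nat.eq_zero_or_pos (h z) with hz | hz
    · exact Or.inl ⟨⟨π z, Nat.lt_succ_of_le (H.proj_le z)⟩,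
        ((H.height_eq_zero_iff hT).mp hz).symm⟩
    · obtain ⟨k, hk⟩ := (hx.2 z).mpr hz
      exact Or.inr ⟨k.succ, hk⟩
  have hpath : ∀ {m : ℕ} (a b : Fin m), |(a : ℝ) - b| = 1 ↔ (pathGraph m).Adj a b := by
    intro m a b
    rw [pathGraph_adj, abs_eq one_pos.le, sub_eq_iff_eq_add, sub_eq_iff_eq_add,
      eq_neg_add_iff_add_eq]
    norm_cast
    omega
  refine ⟨f, g, ⟨i, Nat.lt_succ_of_le hid⟩, fun a ha => ?_, fun a ha => ?_, himid, hg0, ?_,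
    Set.eq_univ_of_forall hcover, ?_⟩
  · change s a = u
    rw [ha, H.start]
  · change s a = v
    rw [Nat.succ_injective ha, H.finish]
  · ext z
    rw [Set.mem_singleton_iff]
    constructor
    · rintro ⟨⟨a, rfl⟩, ⟨p, hp⟩⟩
      have h1 := hfg a p
      rw [hp, dist_self, Nat.cast_zero] at h1
      have h2 : (0 : ℝ) ≤ p := Nat.cast_nonneg _
      have h3 := abs_nonneg ((a : ℝ) - i)
      have h4 : (a : ℝ) - i = 0 := abs_eq_zero.mp (by linarith)
      rw [sub_eq_zero, Nat.cast_inj] at h4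
      exact congrArg f (Fin.ext h4)
    · rintro rfl
      exact ⟨⟨_, rfl⟩, ⟨0, hg0⟩⟩
  · have hmixed : ∀ a p, T.Adj (f a) (g p) →
        ((pathGraph (d + 1)).map f ⊔ (pathGraph (Fintype.card V - (d + 1) + 1)).map g).Adj (f a) (g p) := by
      intro a p hadj
      have h1 := hfg a p
      rw [dist_eq_one_iff_adj.mpr hadj, Nat.cast_one] at h1
      induction p using Fin.cases with
      | zero =>
        refine Or.inl ((map_adj _ _ _ _).mpr ⟨a, _, (hpath _ _).mp ?_, rfl, hg0.symm⟩)
        simpa using h1.symm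
      | succ k =>
        rw [Fin.val_succ] at h1
        push_cast at h1
        have h2 : (0 : ℝ) ≤ (k : ℕ) := Nat.cast_nonneg _
        have h3 := abs_nonneg ((a : ℝ) - i)
        have h4 : (a : ℝ) - i = 0 := abs_eq_zero.mp (by linarith)
        have h5 : ((k : ℕ) : ℝ) = 0 := by linarith
        rw [sub_eq_zero, Nat.cast_inj] at h4
        rw [Nat.cast_eq_zero] at h5
        refine Or.inr ((map_adj _ _ _ _).mpr ⟨0, k.succ, pathGraph_adj.mpr (Or.inl ?_), ?_, rfl⟩)
        · simp [h5]
        · exact hg0.trans (congrArg f (Fin.ext h4.symm))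
    apply le_antisymm
    · intro y z hyz
      rcases hcover y with ⟨a, rfl⟩ | ⟨p, rfl⟩ <;> rcases hcover z with ⟨b, rfl⟩ | ⟨q, rfl⟩
      · refine Or.inl ((map_adj _ _ _ _).mpr ⟨a, b, (hpath _ _).mp ?_, rfl, rfl⟩)
        rw [← hff, dist_eq_one_iff_adj.mpr hyz, Nat.cast_one]
      · exact hmixed a q hyz
      · exact (hmixed b p hyz.symm).symm
      · refine Or.inr ((map_adj _ _ _ _).mpr ⟨p, q, (hpath _ _).mp ?_, rfl, rfl⟩)
        rw [← hgg, dist_eq_one_iff_adj.mpr hyz, Nat.cast_one]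
    · refine sup_le ?_ ?_ <;> intro y z hyz <;>
        obtain ⟨a, b, hab, rfl, rfl⟩ := (map_adj _ _ _ _).mp hyz <;>
        rw [← dist_eq_one_iff_adj, ← Nat.cast_inj (R := ℝ), Nat.cast_one]
      · rw [hff, hpath]; exact hab
      · rw [hgg, hpath]; exact hab

theorem exists_enumeration_of_isTShaped (H : IsPathProjection T u v d s π h) (hT : T.IsTree)
    (hS : T.IsTShaped u v (d + 1)) :
    ∃ (N : ℕ) (x : Fin N → V) (i : ℕ), IsEnumeration h x ∧
      (i + 1 = (d + 1 + 1) / 2 ∨ i + 1 = (d + 1 + 2) / 2) ∧ (∀ k, π (x k) = i) ∧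
      (∀ k, h (x k) = k + 1) ∧ ∀ k l, (T.dist (x k) (x l) : ℝ) = |(k : ℝ) - l| := by
  obtain ⟨f, g, i, hu, hv, hmid, hg0, hinter, hunion, hTeq⟩ := hS
  have hf : (pathGraph (d + 1)).map f ≤ T := hTeq ▸ le_sup_left
  have hg : (pathGraph (Fintype.card V - (d + 1) + 1)).map g ≤ T := hTeq ▸ le_sup_right
  have hfu : f 0 = u := hu 0 rfl
  have hfv : f (Fin.last d) = v := hv _ rfl
  have hcoord : ∀ (z : V) (t p : ℝ), (T.dist z u : ℝ) = t + p → (T.dist z v : ℝ) = t + (d - p) →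
      (h z : ℝ) = t ∧ (π z : ℝ) = p := by
    intro z t p h1 h2
    rw [H.dist_start] at h1
    rw [H.dist_finish] at h2
    constructor <;> linarith
  have hle : ∀ a : Fin (d + 1), (a : ℝ) ≤ d := fun a => by
    exact_mod_cast Nat.le_of_lt_succ a.2
  have hfa : ∀ a, h (f a) = 0 := by
    intro a
    have h1 := hT.dist_embedding hf a 0
    have h2 := hT.dist_embedding hf a (Fin.last d)
    rw [hfu, Fin.val_zero, Nat.cast_zero, sub_zero, Nat.abs_cast] at h1
    rw [hfv, Fin.val_last, abs_of_nonpos (by linarith [hle a])] at h2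
    have := (hcoord (f a) 0 a (by linarith) (by linarith)).1
    exact_mod_cast this
  have hgk : ∀ k, h (g k) = k ∧ π (g k) = i := by
    intro k
    have h1 := hT.dist_attached_path hf hg hg0 hinter k 0
    have h2 := hT.dist_attached_path hf hg hg0 hinter k (Fin.last d)
    rw [hfu, Fin.val_zero, Nat.cast_zero, sub_zero, Nat.abs_cast] at h1
    rw [hfv, Fin.val_last, abs_of_nonpos (by linarith [hle i])] at h2
    have := hcoord (g k) k i (by linarith) (by linarith)
    exact_mod_cast this
  refine ⟨Fintype.card V - (d + 1), fun k => g k.succ, i,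
    ⟨g.injective.comp (Fin.succ_injective _), fun z => ?_⟩, hmid, fun k => (hgk _).2,
    fun k => (hgk _).1, fun k l => ?_⟩
  · constructor
    · rintro ⟨k, rfl⟩
      rw [(hgk _).1]
      exact Nat.succ_pos _
    · intro hz
      have hmem : z ∈ Set.range f ∪ Set.range g := hunion ▸ Set.mem_univ z
      rcases hmem with ⟨a, rfl⟩ | ⟨p, rfl⟩
      · rw [hfa] at hz
        omega
      · rw [(hgk _).1] at hz
        obtain ⟨k, rfl⟩ := Fin.exists_succ_eq.mpr
          (show p ≠ 0 from fun h0 => by simp [h0] at hz)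
        exact ⟨k, rfl⟩
  · rw [hT.dist_embedding hg, Fin.val_succ, Fin.val_succ]
    push_cast
    rw [add_sub_add_right_eq_sub]

end IsPathProjection

end SimpleGraph

theorem theorem3p1 {V : Type*} [Fintype V] [DecidableEq V] (T G : SimpleGraph V) (n c : ℕ)
    (hT : T.IsTree) (hn : Fintype.card V = n) (hn4 : 4 ≤ n)
    (u v : V) (huv : u ≠ v) (hnadj : ¬ T.Adj u v) (hG : G = T ⊔ SimpleGraph.edge u v)
    (hc : ∃ (x : V) (C : G.Walk x x), C.IsCycle ∧ C.length = c) :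
    ∃ κT κG : ℝ≥0,
      IsKemenyConstant T.randomWalkMatrix κT ∧ IsKemenyConstant G.randomWalkMatrix κG ∧
      (κG : ℝ) - (κT : ℝ) ≤ kemenyIncreaseBound n c ∧
      ((κG : ℝ) - (κT : ℝ) = kemenyIncreaseBound n c ↔ T.IsTShaped u v c) := by
  obtain ⟨y, C, hC, rfl⟩ := hc
  rw [hT.length_of_isCycle_sup_edge hG huv hC]
  have : Nontrivial V := ⟨u, v, huv⟩
  obtain ⟨κT, κG, hκT, hκG, hκ⟩ := hT.exists_isKemenyConstant_sub hG huv hnadj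
  refine ⟨κT, κG, hκT, hκG, ?_⟩
  obtain ⟨s, π, h, H⟩ := hT.exists_isPathProjection u v
  have hd : 1 ≤ T.dist u v := hT.connected.pos_dist_of_ne huv
  have hn4' : (4 : ℝ) ≤ n := by exact_mod_cast hn4
  have hpos : (0 : ℝ) < 4 * n * (n - 1) := mul_pos (by linarith) (by linarith)
  have hr : (0 : ℝ) < (n - 1) / (T.dist u v + 1) := div_pos (by linarith) (by positivity)
  rw [hn] at hκ
  have hgap := fun {N : ℕ} {x : Fin N → V} (hx : SimpleGraph.IsEnumeration h x) =>
    H.kemenyIncreaseBound_sub hT.connected hx hd hn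
  simp only [← hκ, ← mul_sub (4 * (n : ℝ) * (n - 1))] at hgap
  obtain ⟨N, x, hx, hmono, hle⟩ := H.exists_enumeration hT
  have hgapx := hgap hx
  have hmid := fun k => (mod_two_div_four_le (T.dist u v) (π (x k))).1
  have hpair := fun k l => H.pair_nonneg hT.connected hle hr k l
  have hpair' : ∀ k l : Fin N, (0 : ℝ) ≤ if k = l then 0 else (T.dist (x k) (x l) +
        (n - 1) / (T.dist u v + 1) * ((π (x k) : ℝ) - π (x l)) ^ 2 - h (x k) - h (x l) +
          2 * ((min (k : ℕ) l : ℕ) + 1)) := by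
    intro k l
    split_ifs
    · exact le_rfl
    · exact (hpair k l).1
  have hA : 0 ≤ ∑ k, (((π (x k) : ℝ) - (T.dist u v : ℕ) / 2) ^ 2 -
      ((T.dist u v % 2 : ℕ) : ℝ) / 4) :=
    Finset.sum_nonneg fun k _ => sub_nonneg.mpr (hmid k)
  have hB := Finset.sum_nonneg fun k (_ : k ∈ Finset.univ) =>
    Finset.sum_nonneg fun l (_ : l ∈ Finset.univ) => hpair' k l
  have h8 : (0 : ℝ) < 8 * n := by linarith
  have hA' := mul_nonneg h8.le hA
  constructor
  · have h0 : 0 ≤ 4 * (n : ℝ) * (n - 1) * (kemenyIncreaseBound n (T.dist u v + 1) - (κG - κT)) := by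
      rw [hgapx]
      linarith
    exact sub_nonneg.mp (nonneg_of_mul_nonneg_right h0 hpos)
  · constructor
    · intro heq
      rw [← heq, sub_self, mul_zero] at hgapx
      have hA0 := (mul_eq_zero.mp (le_antisymm (by linarith) hA')).resolve_left h8.ne'
      rw [hA0, mul_zero, zero_add, eq_comm, mul_eq_zero, or_iff_right four_ne_zero] at hgapx
      rw [Finset.sum_eq_zero_iff_of_nonneg fun k _ => sub_nonneg.mpr (hmid k)] at hA0
      rw [Finset.sum_eq_zero_iff_of_nonneg fun k _ => Finset.sum_nonneg fun l _ => hpair' k l]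
        at hgapx
      refine H.isTShaped hT.connected hx hmono hle (fun k => ?_) fun k l hkl => ?_
      · exact (mod_two_div_four_le _ _).2.mp (sub_eq_zero.mp (hA0 k (Finset.mem_univ k)))
      · have h1 := hgapx k (Finset.mem_univ k)
        rw [Finset.sum_eq_zero_iff_of_nonneg fun l _ => hpair' k l] at h1
        have h2 := h1 l (Finset.mem_univ l)
        rw [if_neg hkl] at h2
        exact (hpair k l).2 h2
    · intro hS
      obtain ⟨M, y, i, hy, hi, hπ, hh, hdist⟩ := H.exists_enumeration_of_isTShaped hT hS
      have hgapy := hgap hy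
      rw [Finset.sum_eq_zero, Finset.sum_eq_zero, mul_zero, mul_zero, add_zero, mul_eq_zero,
        or_iff_right hpos.ne', sub_eq_zero] at hgapy
      · exact hgapy.symm
      · intro k _
        refine Finset.sum_eq_zero fun l _ => ?_
        split_ifs with hkl
        · rfl
        · rw [hdist, hh, hh, hπ, hπ]
          rcases le_total (k : ℕ) l with hle | hle
          · have : ((k : ℕ) : ℝ) ≤ (l : ℕ) := by exact_mod_cast hle
            rw [min_eq_left hle, abs_of_nonpos (by linarith)]
            push_cast
            ring
          · have : ((l : ℕ) : ℝ) ≤ (k : ℕ) := by exact_mod_cast hle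
            rw [min_eq_right hle, abs_of_nonneg (by linarith)]
            push_cast
            ring
      · intro k _
        rw [hπ, sub_eq_zero]
        exact (mod_two_div_four_le _ _).2.mpr hi
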